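/- All manifolds are smooth, finite-dimensional, Hausdorff and second countable, without boundary. A bivector field $\Lambda$ is identified with the map $\Lambda:T^*M\to TM$, $\langle\beta,\Lambda\alpha\rangle=\Lambda(\alpha,\beta)$. A pair $(\Lambda,E)$ of a bivector field and a vector field is a Jacobi structure if $\{f,g\}=\Lambda(df,dg)+\langle f\,dg-g\,df,E\rangle$ satisfies the Jacobi identity on $C^\infty(M)$; $\pi$ is Poisson if $(\pi,0)$ is Jacobi. Two Jacobi structures are compatible if $\{\cdot,\cdot\}_1-\lambda\{\cdot,\cdot\}_2$ is the bracket of a Jacobi structure for every $\lambda\in\mathbb R$. A map $\psi:(M_1,\Lambda_1,E_1)\to(M_2,\Lambda_2,E_2)$ between Jacobi manifolds is a conformal Jacobi morphism if it is smooth and there is a nowhere vanishing $a\in C^\infty(M_1)$ with $\{a(f\circ\psi),a(g\circ\psi)\}_1=a(\{f,g\}_2\circ\psi)$ for all $f,g\in C^\infty(M_2)$. A Nijenhuis tensor is a $(1,1)$-tensor field $J$ with vanishing torsion $N_J(X,Y)=[JX,JY]-J[JX,Y]-J[X,JY]+J^2[X,Y]$. Put $\{\alpha,\beta\}_\Lambda=L_{\Lambda\alpha}\beta-L_{\Lambda\beta}\alpha-d(\Lambda(\alpha,\beta))$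 and, when $J\circ\Lambda=\Lambda\circ{}^tJ$, $C(\Lambda,J)(\alpha,\beta)=\{\alpha,\beta\}_{J\Lambda}-(\{{}^tJ\alpha,\beta\}_\Lambda+\{\alpha,{}^tJ\beta\}_\Lambda-{}^tJ\{\alpha,\beta\}_\Lambda)$. A Nijenhuis tensor $J$ is compatible with a Jacobi structure $(\Lambda,E)$ if (i) $J\circ\Lambda=\Lambda\circ{}^tJ$; (ii) $\langle{}^tJ\gamma,\ \Lambda(C(\Lambda,J)(\alpha,\beta))-\Lambda(\alpha,\beta)JE+\Lambda(\alpha,{}^tJ\beta)E\rangle=0$ for all 1-forms $\alpha,\beta,\gamma$; (iii) $[J^kE,\Lambda]+[E,J^k\Lambda]=0$ for all $k\ge1$. A Poisson–Nijenhuis structure $(\pi,J)$ is a Poisson tensor $\pi$ with a Nijenhuis tensor $J$ such that $J\circ\pi=\pi\circ{}^tJ$ and $C(\pi,J)=0$. It is homogeneous with respect to a vector field $Z$ if $[Z,\pi]=-\pi$ and $\pi\circ(L_Z\circ{}^tJ-{}^tJ\circ L_Z)=0$ on 1-forms. **Corollary.** (1) Let $(\Lambda,E)$ be a Jacobi structure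 on $M$ and $J$ a Nijenhuis tensor on $M$ compatible with $(\Lambda,E)$. Then $(J^k\Lambda,J^kE)$ is a Jacobi structure for every $k\ge0$, and there is a sequence $(\pi_k)_{k\ge0}$ of Poisson structures on $M\times\mathbb R$, each forming a Poisson–Nijenhuis structure $(\pi_k,K_k)$ with some Nijenhuis tensor $K_k$ on $M\times\mathbb R$, such that for every $k\ge0$ the projection $(M\times\mathbb R,\pi_k)\to(M,J^k\Lambda,J^kE)$ is a conformal Jacobi morphism. In particular, for $k=0$ the target is $(M,\Lambda,E)$. (2) Conversely, let $(\pi,J)$ be a Poisson–Nijenhuis structure on $M$ that is homogeneous with respect to the vector field $Z$, and let $\iota:N\to M$ be an immersed (for instance, an embedded) submanifold of codimension 1, transverse to $Z$. Then for every $k\ge0$ there is exactly one pair $(\Lambda_k,E_k)$ of fields on $N$ with $J^k\pi=\iota_*\Lambda_k+Z\wedge\iota_*E_k$ along $N$. Each $(\Lambda_k,E_k)$ is a Jacobi structure on $N$, these Jacobi structures are pairwise compatible, and whenever $f,g$ are smooth functions on an open set $U\subset M$ with $\langle Z,df\rangle=f$ and $\langle Z,dg\rangle=g$ on $U$, the bracket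 $\{\cdot,\cdot\}_k$ of $(\Lambda_k,E_k)$ satisfies $\{f|_N,g|_N\}_k=(J^k\pi)(df,dg)|_N$ on $N\cap U$. -/

import Mathlib

open Bundle Manifold
open scoped ContDiff

namespace JacobiNijenhuis

section Definitions

variable {E : Type*} [NormedAddCommGroup E] [NormedSpace ℝ E]
  {H : Type*} [TopologicalSpace H] (I : ModelWithCorners ℝ E H)
  {M : Type*} [TopologicalSpace M] [ChartedSpace H M]

/-! ### Tensor fields -/

/-- Vector fields on `M` (no regularity). -/
abbrev Vec (M : Type*) [TopologicalSpace M] [ChartedSpace H M] :=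
  Π x : M, TangentSpace I x

/-- Fields of covectors on `M` (no regularity). -/
abbrev Form (M : Type*) [TopologicalSpace M] [ChartedSpace H M] :=
  Π x : M, TangentSpace I x →L[ℝ] ℝ

/-- Fields of linear maps `T*M → TM` (no regularity). A bivector field `Λ` is represented by its
linear map `α ↦ Λ α`, with `Λ(α, β) = ⟨β, Λ α⟩`; it has to be smooth and skew-symmetric, see
`IsBivector`. -/
abbrev Biv (M : Type*) [TopologicalSpace M] [ChartedSpace H M] :=
  Π x : M, (TangentSpace I x →L[ℝ] ℝ) →L[ℝ] TangentSpace I x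

/-- Fields of endomorphisms of `TM`, i.e. (1,1)-tensor fields (no regularity). -/
abbrev Endo (M : Type*) [TopologicalSpace M] [ChartedSpace H M] :=
  Π x : M, TangentSpace I x →L[ℝ] TangentSpace I x

/-- Smooth real functions on `M`. -/
def SmoothFun (f : M → ℝ) : Prop := ContMDiff I 𝓘(ℝ, ℝ) ∞ f

/-- Smoothness of a vector field: it is a smooth section of the tangent bundle. -/
def SmoothVec [IsManifold I ∞ M] (X : Vec I M) : Prop :=
  ContMDiff I (I.prod 𝓘(ℝ, E)) ∞
    (fun x => TotalSpace.mk' E (E := fun x : M => TangentSpace I x) x (X x))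

/-- Smoothness of a 1-form: it is a smooth section of the cotangent bundle. -/
def SmoothForm [IsManifold I ∞ M] (α : Form I M) : Prop :=
  ContMDiff I (I.prod 𝓘(ℝ, E →L[ℝ] ℝ)) ∞
    (fun x => TotalSpace.mk' (E →L[ℝ] ℝ)
      (E := fun x : M => TangentSpace I x →L[ℝ] Trivial M ℝ x) x (α x))

/-- Smoothness of a (1,1)-tensor field: it is a smooth section of `Hom(TM, TM)`. -/
def SmoothEndo [IsManifold I ∞ M] (J : Endo I M) : Prop :=
  ContMDiff I (I.prod 𝓘(ℝ, E →L[ℝ] E)) ∞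
    (fun x => TotalSpace.mk' (E →L[ℝ] E)
      (E := fun x : M => TangentSpace I x →L[ℝ] TangentSpace I x) x (J x))

/-- A bivector field: a smooth skew-symmetric section of `Hom(T*M, TM)`. -/
structure IsBivector [IsManifold I ∞ M] (Λ : Biv I M) : Prop where
  smooth : ContMDiff I (I.prod 𝓘(ℝ, (E →L[ℝ] ℝ) →L[ℝ] E)) ∞
    (fun x => TotalSpace.mk' ((E →L[ℝ] ℝ) →L[ℝ] E)
      (E := fun x : M => (TangentSpace I x →L[ℝ] Trivial M ℝ x) →L[ℝ] TangentSpace I x) x (Λ x))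
  skew : ∀ (x : M) (a b : TangentSpace I x →L[ℝ] ℝ), b (Λ x a) = - a (Λ x b)

/-! ### Algebraic operations -/

/-- The function `Λ(α, β) = ⟨β, Λ α⟩`. -/
noncomputable def pair (Λ : Biv I M) (α β : Form I M) : M → ℝ := fun x => β x (Λ x (α x))

/-- The vector field `Λ α`. -/
noncomputable def sharp (Λ : Biv I M) (α : Form I M) : Vec I M := fun x => Λ x (α x)

/-- The vector field `J X`. -/
noncomputable def app (J : Endo I M) (X : Vec I M) : Vec I M := fun x => J x (X x)

/-- The 1-form `ᵗJ α = α ∘ J`. -/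
noncomputable def transp (J : Endo I M) (α : Form I M) : Form I M := fun x => (α x).comp (J x)

/-- The tensor field `J ∘ Λ`. -/
noncomputable def comp (J : Endo I M) (Λ : Biv I M) : Biv I M := fun x => (J x).comp (Λ x)

/-- The power `J ^ k` (with `J ^ 0` the identity). -/
noncomputable def power (J : Endo I M) (k : ℕ) : Endo I M := fun x => J x ^ k

/-- `J ∘ Λ = Λ ∘ ᵗJ`. -/
def Commutes (J : Endo I M) (Λ : Biv I M) : Prop :=
  ∀ (x : M) (a : TangentSpace I x →L[ℝ] ℝ), J x (Λ x a) = Λ x (a.comp (J x))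

/-! ### Lie derivatives -/

/-- The value at `x` of `(L_X α)(Y) = X(α(Y)) - α([X, Y])`. -/
noncomputable def lieEval (X : Vec I M) (α : Form I M) (x : M) (Y : Vec I M) : ℝ :=
  mvfderiv I (fun y => α y (Y y)) x (X x) - α x (VectorField.mlieBracket I X Y x)

open Classical in
/-- The Lie derivative `L_X α` of a 1-form, characterized by `(L_X α)(Y) = X(α(Y)) - α([X, Y])`,
see `lieForm_apply`. The expression `lieEval I X α x Y` depends only on the value of `Y` at `x` when
`X` and `α` are smooth; the default value `0` only concerns fields that are not smooth. -/
noncomputable def lieForm [FiniteDimensional ℝ E] [IsManifold I ∞ M]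
    (X : Vec I M) (α : Form I M) : Form I M := fun x =>
  if h : TensorialAt I E (lieEval I X α x) x then
    TensorialAt.mkHom (lieEval I X α x) x h
  else 0

/-- The Lie derivative of a bivector field,
`[X, Λ](α, β) = X(Λ(α, β)) - Λ(L_X α, β) - Λ(α, L_X β)`. -/
noncomputable def lieBiv [FiniteDimensional ℝ E] [IsManifold I ∞ M]
    (X : Vec I M) (Λ : Biv I M) (α β : Form I M) : M → ℝ := fun x =>
  mvfderiv I (pair I Λ α β) x (X x) - pair I Λ (lieForm I X α) β x
    - pair I Λ α (lieForm I X β) x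

lemma tensorialAt_lieEval [FiniteDimensional ℝ E] [IsManifold I ∞ M]
    {X : Vec I M} {α : Form I M} (hα : SmoothForm I α) (x : M) :
    TensorialAt I E (lieEval I X α x) x := by
  have key : ∀ {Y : Vec I M}, MDifferentiableAt I (I.prod 𝓘(ℝ, E))
      (fun x => TotalSpace.mk' E (E := fun x : M => TangentSpace I x) x (Y x)) x →
      MDifferentiableAt I 𝓘(ℝ, ℝ) (fun y => α y (Y y)) x := by
    intro Y hY
    have h := (hα x).mdifferentiableAt (by simp)
    have h2 := MDifferentiableAt.clm_bundle_apply (F₁ := E) (F₂ := ℝ)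
      (E₁ := fun x : M => TangentSpace I x) (E₂ := Trivial M ℝ)
      (b := fun x => x) (ϕ := fun x => α x) (v := Y) h hY
    rw [mdifferentiableAt_totalSpace] at h2
    exact h2.2
  constructor
  · intro f Y hf hY
    have e : (fun y => α y ((f • Y) y)) = f * (fun y => α y (Y y)) := by
      ext y; simp
    simp only [lieEval, e]
    rw [VectorField.mlieBracket_smul_right hf hY, mvfderiv_mul hf (key hY)]
    simp
    ring
  · intro Y Y' hY hY'
    have e : (fun y => α y ((Y + Y') y)) = (fun y => α y (Y y)) + (fun y => α y (Y' y)) := by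
      ext y; simp
    simp only [lieEval, e]
    rw [VectorField.mlieBracket_add_right hY hY', mvfderiv_add (key hY) (key hY')]
    simp
    ring

lemma lieForm_apply [FiniteDimensional ℝ E] [IsManifold I ∞ M]
    {X Y : Vec I M} {α : Form I M} (hα : SmoothForm I α) (hY : SmoothVec I Y) (x : M) :
    lieForm I X α x (Y x) =
      mvfderiv I (fun y => α y (Y y)) x (X x) - α x (VectorField.mlieBracket I X Y x) := by
  have h := tensorialAt_lieEval I (X := X) hα x
  simp only [lieForm, dif_pos h]
  exact TensorialAt.mkHom_apply h ((hY x).mdifferentiableAt (by simp))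

/-! ### Jacobi and Poisson structures -/

/-- The bracket `{f, g} = Λ(df, dg) + ⟨f dg - g df, V⟩` of a bivector field `Λ` and a vector
field `V`. -/
noncomputable def bracket (Λ : Biv I M) (V : Vec I M) (f g : M → ℝ) : M → ℝ := fun x =>
  mvfderiv I g x (Λ x (mvfderiv I f x))
    + (f x * mvfderiv I g x (V x) - g x * mvfderiv I f x (V x))

/-- `(Λ, V)` is a Jacobi structure: `Λ` is a bivector field, `V` is a smooth vector field, and their
bracket satisfies the Jacobi identity. (It is bilinear, skew-symmetric and local by its form.) -/
structure IsJacobi [IsManifold I ∞ M] (Λ : Biv I M) (V : Vec I M) : Prop where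
  isBivector : IsBivector I Λ
  smoothVec : SmoothVec I V
  jacobi : ∀ f g h : M → ℝ, SmoothFun I f → SmoothFun I g → SmoothFun I h → ∀ x : M,
    bracket I Λ V f (bracket I Λ V g h) x + bracket I Λ V g (bracket I Λ V h f) x
      + bracket I Λ V h (bracket I Λ V f g) x = 0

/-- A Poisson structure is a Jacobi structure with zero vector field. -/
def IsPoisson [IsManifold I ∞ M] (P : Biv I M) : Prop := IsJacobi I P (fun _ => 0)

/-- Two Jacobi structures are compatible if they define a Jacobi pencil: the difference
`{·,·}₁ - c {·,·}₂` of their brackets is the bracket of a Jacobi structure for all real `c`. -/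
def AreCompatible [IsManifold I ∞ M] (Λ₁ : Biv I M) (V₁ : Vec I M) (Λ₂ : Biv I M) (V₂ : Vec I M) :
    Prop :=
  IsJacobi I Λ₁ V₁ ∧ IsJacobi I Λ₂ V₂ ∧
    ∀ c : ℝ, IsJacobi I (fun x => Λ₁ x - c • Λ₂ x) (fun x => V₁ x - c • V₂ x)

/-! ### Nijenhuis tensors and compatibility -/

/-- The Nijenhuis torsion `N_J(X, Y) = [JX, JY] - J[JX, Y] - J[X, JY] + J²[X, Y]`. -/
noncomputable def torsion (J : Endo I M) (X Y : Vec I M) : Vec I M := fun x =>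
  VectorField.mlieBracket I (app I J X) (app I J Y) x
    - J x (VectorField.mlieBracket I (app I J X) Y x)
    - J x (VectorField.mlieBracket I X (app I J Y) x)
    + J x (J x (VectorField.mlieBracket I X Y x))

/-- A Nijenhuis tensor: a smooth (1,1)-tensor field whose Nijenhuis torsion vanishes. -/
structure IsNijenhuis [IsManifold I ∞ M] (J : Endo I M) : Prop where
  smooth : SmoothEndo I J
  torsion_eq_zero : ∀ X Y : Vec I M, SmoothVec I X → SmoothVec I Y → ∀ x : M,
    torsion I J X Y x = 0

/-- The bracket of 1-forms `{α, β}_Λ = L_{Λα} β - L_{Λβ} α - d(Λ(α, β))`. -/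
noncomputable def formBracket [FiniteDimensional ℝ E] [IsManifold I ∞ M]
    (Λ : Biv I M) (α β : Form I M) : Form I M := fun x =>
  lieForm I (sharp I Λ α) β x - lieForm I (sharp I Λ β) α x - mvfderiv I (pair I Λ α β) x

/-- The concomitant
`C(Λ, J)(α, β) = {α, β}_{JΛ} - ({ᵗJ α, β}_Λ + {α, ᵗJ β}_Λ - ᵗJ {α, β}_Λ)`. -/
noncomputable def concomitant [FiniteDimensional ℝ E] [IsManifold I ∞ M]
    (Λ : Biv I M) (J : Endo I M) (α β : Form I M) : Form I M := fun x =>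
  formBracket I (comp I J Λ) α β x
    - (formBracket I Λ (transp I J α) β x + formBracket I Λ α (transp I J β) x
        - transp I J (formBracket I Λ α β) x)

/-- Compatibility of a (1,1)-tensor field `J` with a Jacobi structure `(Λ, V)`. -/
structure IsCompatible [FiniteDimensional ℝ E] [IsManifold I ∞ M]
    (Λ : Biv I M) (V : Vec I M) (J : Endo I M) : Prop where
  torsion_sharp_sharp : ∀ α β : Form I M, SmoothForm I α → SmoothForm I β → ∀ x : M,
    torsion I J (sharp I Λ α) (sharp I Λ β) x = 0
  torsion_sharp_vec : ∀ (α : Form I M) (k : ℕ), SmoothForm I α → ∀ x : M,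
    torsion I J (sharp I Λ α) (app I (power I J k) V) x = 0
  commutes : Commutes I J Λ
  concomitant_eq : ∀ α β γ : Form I M, SmoothForm I α → SmoothForm I β → SmoothForm I γ →
    ∀ x : M, transp I J γ x (Λ x (concomitant I Λ J α β x) - pair I Λ α β x • J x (V x)
      + pair I Λ α (transp I J β) x • V x) = 0
  lie_eq : ∀ k : ℕ, 1 ≤ k → ∀ α β : Form I M, SmoothForm I α → SmoothForm I β → ∀ x : M,
    lieBiv I (app I (power I J k) V) Λ α β x + lieBiv I V (comp I (power I J k) Λ) α β x = 0

/-- Poisson–Nijenhuis structures. -/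
structure IsPoissonNijenhuis [FiniteDimensional ℝ E] [IsManifold I ∞ M]
    (P : Biv I M) (J : Endo I M) : Prop where
  isPoisson : IsPoisson I P
  isNijenhuis : IsNijenhuis I J
  commutes : Commutes I J P
  concomitant_eq_zero : ∀ α β : Form I M, SmoothForm I α → SmoothForm I β → ∀ x : M,
    concomitant I P J α β x = 0

/-- Homogeneous Poisson–Nijenhuis structures with respect to a vector field `Z`: a
Poisson–Nijenhuis structure with `[Z, P] = -P` and `P ∘ (L_Z ∘ ᵗJ - ᵗJ ∘ L_Z) = 0`. -/
structure IsHomogeneousPoissonNijenhuis [FiniteDimensional ℝ E] [IsManifold I ∞ M]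
    (P : Biv I M) (J : Endo I M) (Z : Vec I M) : Prop where
  isPoissonNijenhuis : IsPoissonNijenhuis I P J
  smoothVec : SmoothVec I Z
  homogeneous : ∀ α β : Form I M, SmoothForm I α → SmoothForm I β → ∀ x : M,
    lieBiv I Z P α β x = - pair I P α β x
  comp_eq_zero : ∀ α : Form I M, SmoothForm I α → ∀ x : M,
    P x (lieForm I Z (transp I J α) x - transp I J (lieForm I Z α) x) = 0

/-! ### Conformal Jacobi morphisms and transverse hypersurfaces -/

variable {E' : Type*} [NormedAddCommGroup E'] [NormedSpace ℝ E']
  {H' : Type*} [TopologicalSpace H'] (I' : ModelWithCorners ℝ E' H')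
  {N : Type*} [TopologicalSpace N] [ChartedSpace H' N]

/-- `ψ : (M, Λ₁, V₁) → (N, Λ₂, V₂)` is a conformal Jacobi morphism: there is a smooth nowhere
vanishing function `a` on `M` with `{a (f ∘ ψ), a (g ∘ ψ)}₁ = a ({f, g}₂ ∘ ψ)` for all smooth
functions `f`, `g` on `N`. -/
structure IsConformalJacobiMorphism [IsManifold I ∞ M] [IsManifold I' ∞ N]
    (Λ₁ : Biv I M) (V₁ : Vec I M) (Λ₂ : Biv I' N) (V₂ : Vec I' N) (ψ : M → N) : Prop where
  source : IsJacobi I Λ₁ V₁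
  target : IsJacobi I' Λ₂ V₂
  smooth : ContMDiff I I' ∞ ψ
  conformal : ∃ a : M → ℝ, SmoothFun I a ∧ (∀ x, a x ≠ 0) ∧
    ∀ f g : N → ℝ, SmoothFun I' f → SmoothFun I' g → ∀ x : M,
      bracket I Λ₁ V₁ (fun y => a y * f (ψ y)) (fun y => a y * g (ψ y)) x
        = a x * bracket I' Λ₂ V₂ f g (ψ x)

/-- `ι : N → M` is an immersion of codimension one, transverse to the vector field `Z`. The
inclusion of a submanifold of codimension one which is transverse to `Z` is an instance. -/
structure IsTransverseHypersurface (Z : Vec I M) (ι : N → M) : Prop where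
  smooth : ContMDiff I' I ∞ ι
  injective : ∀ y : N, Function.Injective (mfderiv I' I ι y)
  codim : Module.finrank ℝ E = Module.finrank ℝ E' + 1
  transverse : ∀ y : N, Z (ι y) ∉ Set.range (mfderiv I' I ι y)

/-- The decomposition `P = ι_* Λ + Z ∧ ι_* V` of a bivector field `P` on `M` along a transverse
hypersurface `ι : N → M`, where `(Z ∧ W)(a, b) = a(Z) b(W) - b(Z) a(W)`. -/
def DecomposesAlong (P : Biv I M) (Z : Vec I M) (ι : N → M) (Λ : Biv I' N) (V : Vec I' N) : Prop :=
  ∀ (y : N) (a b : TangentSpace I (ι y) →L[ℝ] ℝ),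
    b (P (ι y) a) =
      (b.comp (mfderiv I' I ι y)) (Λ y (a.comp (mfderiv I' I ι y)))
        + (a (Z (ι y)) * b (mfderiv I' I ι y (V y)) - b (Z (ι y)) * a (mfderiv I' I ι y (V y)))

/-- For all smooth functions `f`, `g` on an open set `U` of `M` with `⟨Z, df⟩ = f` and
`⟨Z, dg⟩ = g` there, the bracket of their restrictions to `N` with respect to `(Λ, V)` is the
restriction of `P(df, dg)`. -/
def RestrictsBracket (P : Biv I M) (Z : Vec I M) (ι : N → M) (Λ : Biv I' N) (V : Vec I' N) : Prop :=
  ∀ (U : Set M) (f g : M → ℝ), IsOpen U →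
    ContMDiffOn I 𝓘(ℝ, ℝ) ∞ f U → ContMDiffOn I 𝓘(ℝ, ℝ) ∞ g U →
    (∀ x ∈ U, mvfderiv I f x (Z x) = f x) → (∀ x ∈ U, mvfderiv I g x (Z x) = g x) →
    ∀ y : N, ι y ∈ U →
      bracket I' Λ V (f ∘ ι) (g ∘ ι) y = mvfderiv I g (ι y) (P (ι y) (mvfderiv I f (ι y)))

end Definitions

end JacobiNijenhuis

/-!
Write `{f, g} = Λ(df, dg) + f V(g) - g V(f)`. The Jacobi identity for this bracket is equivalent to
two identities for the Hamiltonian fields: `V` preserves `Λ`, and `[Λ df, Λ dg]` differs from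
`Λ d(Λ(df, dg))` by the terms `Λ(df, dg) V`, `V(f) Λ dg` and `V(g) Λ df`. A tensor `J` is Nijenhuis
exactly when `L_{JX} J = J ∘ L_X J` for all `X`, and together with the compatibility conditions this
carries the two identities from `(Λ, V)` to every `(J^k Λ, J^k V)`. The Poissonization
`e⁻ᵗ (Λ + ∂ₜ ∧ V)` turns each of these Jacobi structures into a Poisson structure on `M × ℝ` that
projects onto it.

For the converse, `J^k` and `J^k - c J^l` are again Nijenhuis tensors forming homogeneous
Poisson–Nijenhuis structures with `π`, which settles compatibility once each single pair is known to
be Jacobi. For the latter, a function on `N` extends near a point of `N` to a function that is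
homogeneous to second order along `N`, i.e. `Z f - f` vanishes on `N` together with its
differential; restriction to `N` takes Poisson brackets of such extensions to Jacobi brackets, so
the Jacobi identity on `N` is inherited from `M`.
-/

namespace JacobiNijenhuis

open Set Filter Topology VectorField

/-! ### Differentials and Lie brackets -/

section Differentials

variable {E : Type*} [NormedAddCommGroup E] [NormedSpace ℝ E]
  {H : Type*} [TopologicalSpace H] {I : ModelWithCorners ℝ E H}
  {M : Type*} [TopologicalSpace M] [ChartedSpace H M] {f g : M → ℝ} {x : M}

lemma mvfderiv_congr (h : f =ᶠ[𝓝 x] g) : mvfderiv I f x = mvfderiv I g x := by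
  ext v
  exact congrArg (fun L : E →L[ℝ] ℝ => L v) (h.mfderiv_eq (I := I) (I' := 𝓘(ℝ, ℝ)))

lemma SmoothFun.mdifferentiableAt {f : M → ℝ} (hf : SmoothFun I f) (x : M) :
    MDifferentiableAt I 𝓘(ℝ, ℝ) f x :=
  (hf x).mdifferentiableAt (by simp)

lemma SmoothFun.smoothForm [IsManifold I ∞ M] {f : M → ℝ} (hf : SmoothFun I f) :
    SmoothForm I (mvfderiv I f) := by
  intro x
  rw [contMDiffAt_hom_bundle]
  refine ⟨contMDiffAt_id, ((hf x).mfderiv_const (m := ∞) (by simp)).congr_of_eventuallyEq ?_⟩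
  filter_upwards with y
  ext v
  simp only [inTangentCoordinates, ContinuousLinearMap.inCoordinates, mvfderiv,
    Trivial.fiberBundle_trivializationAt', Trivial.continuousLinearMapAt_trivialization,
    ContinuousLinearMap.id_comp, ContinuousLinearMap.comp_apply,
    TangentBundle.continuousLinearMapAt_model_space]
  rfl

lemma SmoothForm.smoothFun_apply [IsManifold I ∞ M] {α : Form I M} {X : Vec I M}
    (hα : SmoothForm I α) (hX : SmoothVec I X) : SmoothFun I (fun y => α y (X y)) := by
  intro x
  have h := ContMDiffAt.clm_bundle_apply (F₁ := E) (F₂ := ℝ)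
      (E₁ := fun x : M => TangentSpace I x) (E₂ := Trivial M ℝ)
      (b := fun x => x) (ϕ := fun x => α x) (v := X) (hα x) (hX x)
  exact (contMDiffAt_totalSpace.1 h).2

lemma SmoothFun.smoothFun_mvfderiv [IsManifold I ∞ M] {f : M → ℝ} {X : Vec I M}
    (hf : SmoothFun I f) (hX : SmoothVec I X) : SmoothFun I (fun y => mvfderiv I f y (X y)) :=
  hf.smoothForm.smoothFun_apply hX

lemma fderivWithin_comp_extChartAt_symm [IsManifold I 1 M] {z : E}
    (hz : z ∈ (extChartAt I x).target)
    (hf : MDifferentiableAt I 𝓘(ℝ, ℝ) f ((extChartAt I x).symm z)) (W : Vec I M) :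
    fderivWithin ℝ (f ∘ (extChartAt I x).symm) (range I) z
        (mpullbackWithin 𝓘(ℝ, E) I (extChartAt I x).symm W (range I) z) =
      mvfderiv I f ((extChartAt I x).symm z) (W ((extChartAt I x).symm z)) := by
  have hchain := mvfderiv_comp_mfderivWithin z hf (mdifferentiableWithinAt_extChartAt_symm hz)
    (I.uniqueMDiffOn z (extChartAt_target_subset_range x hz))
  obtain ⟨A, hA⟩ := isInvertible_mfderivWithin_extChartAt_symm (I := I) hz
  rw [mpullbackWithin_apply, ← mfderivWithin_eq_fderivWithin, ← hA,
    ContinuousLinearMap.inverse_equiv]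
  refine (congrArg (· (A.symm (W ((extChartAt I x).symm z)))) hchain).trans ?_
  rw [ContinuousLinearMap.comp_apply, ← hA]
  exact congrArg (mvfderiv I f _) (A.apply_symm_apply _)

lemma fderivWithin_fderivWithin_comp_extChartAt_symm [IsManifold I 1 M] {W : Vec I M}
    (hf : ∀ y, MDifferentiableAt I 𝓘(ℝ, ℝ) f y)
    (hfW : MDifferentiableAt I 𝓘(ℝ, ℝ) (fun y => mvfderiv I f y (W y)) x) (W' : Vec I M) :
    fderivWithin ℝ (fun z => fderivWithin ℝ (f ∘ (extChartAt I x).symm) (range I) z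
        (mpullbackWithin 𝓘(ℝ, E) I (extChartAt I x).symm W (range I) z)) (range I)
        (extChartAt I x x)
        (mpullbackWithin 𝓘(ℝ, E) I (extChartAt I x).symm W' (range I) (extChartAt I x x)) =
      mvfderiv I (fun y => mvfderiv I f y (W y)) x (W' x) := by
  have heq : (fun z => fderivWithin ℝ (f ∘ (extChartAt I x).symm) (range I) z
      (mpullbackWithin 𝓘(ℝ, E) I (extChartAt I x).symm W (range I) z)) =ᶠ[𝓝[range I]
        (extChartAt I x x)] (fun y => mvfderiv I f y (W y)) ∘ (extChartAt I x).symm := by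
    filter_upwards [extChartAt_target_mem_nhdsWithin x] with z hz
    exact fderivWithin_comp_extChartAt_symm hz (hf _) W
  rw [heq.fderivWithin_eq (heq.self_of_nhdsWithin (mem_range_self _))]
  have hx : (extChartAt I x).symm (extChartAt I x x) = x := extChartAt_to_inv x
  rw [fderivWithin_comp_extChartAt_symm (mem_extChartAt_target x) (hx.symm ▸ hfW), hx]

lemma mvfderiv_mlieBracket_eq_fderivWithin [IsManifold I 1 M]
    (hf : MDifferentiableAt I 𝓘(ℝ, ℝ) f x) (X Y : Vec I M) :
    mvfderiv I f x (mlieBracket I X Y x) =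
      fderivWithin ℝ (f ∘ (extChartAt I x).symm) (range I) (extChartAt I x x)
        (lieBracketWithin ℝ (mpullbackWithin 𝓘(ℝ, E) I (extChartAt I x).symm X (range I))
          (mpullbackWithin 𝓘(ℝ, E) I (extChartAt I x).symm Y (range I)) (range I)
          (extChartAt I x x)) := by
  rw [← mlieBracketWithin_univ, mlieBracketWithin_apply, mfderiv_extChartAt_self, preimage_univ,
    univ_inter, hf.mvfderiv]
  exact congrArg (fderivWithin ℝ (f ∘ (extChartAt I x).symm) (range I) (extChartAt I x x))
    (DFunLike.congr_fun (ContinuousLinearMap.inverse_id (R := ℝ) (M := E)) _)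

theorem mvfderiv_mlieBracket [IsManifold I ∞ M] [CompleteSpace E] {X Y : Vec I M}
    (hf : SmoothFun I f) (hX : SmoothVec I X) (hY : SmoothVec I Y) (x : M) :
    mvfderiv I f x (mlieBracket I X Y x) =
      mvfderiv I (fun y => mvfderiv I f y (Y y)) x (X x)
        - mvfderiv I (fun y => mvfderiv I f y (X y)) x (Y x) := by
  have two_le : (2 : WithTop ℕ∞) ≤ ∞ := WithTop.coe_le_coe.2 le_top
  have : IsManifold I 2 M := IsManifold.of_le two_le
  have : IsManifold I 1 M := IsManifold.of_le one_le_two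
  have hlift {W : Vec I M} (hW : SmoothVec I W) : DifferentiableWithinAt ℝ
      (mpullbackWithin 𝓘(ℝ, E) I (extChartAt I x).symm W (range I)) (range I)
      (extChartAt I x x) := by
    have h := ((hW x).mdifferentiableAt (by simp)).mdifferentiableWithinAt (s := univ)
      |>.differentiableWithinAt_mpullbackWithin_vectorField
    rwa [preimage_univ, univ_inter] at h
  have hfx : ContDiffWithinAt ℝ ∞ (f ∘ (extChartAt I x).symm) (range I) (extChartAt I x x) :=
    (contMDiffAt_iff.1 (hf x)).2
  rw [mvfderiv_mlieBracket_eq_fderivWithin (hf.mdifferentiableAt x),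
    fderivWithin_apply_lieBracket hfx (by simpa using two_le) I.uniqueDiffOn
      (I.range_subset_closure_interior (mem_range_self _)) (mem_range_self _) (hlift hY) (hlift hX),
    fderivWithin_fderivWithin_comp_extChartAt_symm hf.mdifferentiableAt
      ((hf.smoothFun_mvfderiv hY).mdifferentiableAt x),
    fderivWithin_fderivWithin_comp_extChartAt_symm hf.mdifferentiableAt
      ((hf.smoothFun_mvfderiv hX).mdifferentiableAt x)]

end Differentials

section SmoothTensors

variable {E : Type*} [NormedAddCommGroup E] [NormedSpace ℝ E]
  {H : Type*} [TopologicalSpace H] {I : ModelWithCorners ℝ E H}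
  {M : Type*} [TopologicalSpace M] [ChartedSpace H M]

section Closure

variable [IsManifold I ∞ M]

lemma SmoothEndo.smoothVec_app {J : Endo I M} {X : Vec I M}
    (hJ : SmoothEndo I J) (hX : SmoothVec I X) : SmoothVec I (app I J X) :=
  fun x => ContMDiffAt.clm_bundle_apply (F₁ := E) (F₂ := E)
      (E₁ := fun x : M => TangentSpace I x) (E₂ := fun x : M => TangentSpace I x)
      (b := fun x => x) (ϕ := fun x => J x) (v := X) (hJ x) (hX x)

lemma IsBivector.smoothVec_sharp {Λ : Biv I M} {α : Form I M}
    (hΛ : IsBivector I Λ) (hα : SmoothForm I α) : SmoothVec I (sharp I Λ α) :=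
  fun x => ContMDiffAt.clm_bundle_apply (F₁ := E →L[ℝ] ℝ) (F₂ := E)
      (E₁ := fun x : M => TangentSpace I x →L[ℝ] Trivial M ℝ x)
      (E₂ := fun x : M => TangentSpace I x)
      (b := fun x => x) (ϕ := fun x => Λ x) (v := α) (hΛ.smooth x) (hα x)

lemma SmoothEndo.smoothForm_transp {J : Endo I M} {α : Form I M}
    (hJ : SmoothEndo I J) (hα : SmoothForm I α) : SmoothForm I (transp I J α) := by
  intro x
  have hαx := hα x
  have hJx := hJ x
  rw [contMDiffAt_hom_bundle] at hαx hJx ⊢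
  refine ⟨contMDiffAt_id, (hαx.2.clm_comp hJx.2).congr_of_eventuallyEq ?_⟩
  filter_upwards [chart_source_mem_nhds H x] with y hy
  have hy' : y ∈ (trivializationAt E (TangentSpace I) x).baseSet := by simpa using hy
  ext v
  simp only [ContinuousLinearMap.inCoordinates, Trivial.fiberBundle_trivializationAt',
    Trivial.continuousLinearMapAt_trivialization, transp, ContinuousLinearMap.id_comp,
    ContinuousLinearMap.comp_apply]
  exact congrArg (α y)
    ((trivializationAt E (TangentSpace I) x).symmL_continuousLinearMapAt hy' _).symm

end Closure

section Coordinates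

lemma contMDiffAt_of_forall_dual {n : WithTop ℕ∞} {V : Type*} [NormedAddCommGroup V]
    [NormedSpace ℝ V] [FiniteDimensional ℝ V] {u : M → V} {x : M}
    (h : ∀ β : V →L[ℝ] ℝ, ContMDiffAt I 𝓘(ℝ, ℝ) n (fun y => β (u y)) x) :
    ContMDiffAt I 𝓘(ℝ, V) n u x := by
  let e := (Module.finBasis ℝ V).equivFunL
  have hcoord : ContMDiffAt I 𝓘(ℝ, Fin (Module.finrank ℝ V) → ℝ) n (fun y => e (u y)) x :=
    contMDiffAt_pi_space.2 fun i => h ((ContinuousLinearMap.proj i).comp e.toContinuousLinearMap)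
  simpa [Function.comp_def] using e.symm.toContinuousLinearMap.contMDiff.contMDiffAt.comp x hcoord

lemma contMDiffAt_clm_of_forall_apply {n : WithTop ℕ∞} {V W : Type*} [NormedAddCommGroup V]
    [NormedSpace ℝ V] [NormedAddCommGroup W] [NormedSpace ℝ W] [FiniteDimensional ℝ W]
    {u : M → W →L[ℝ] V} {x : M} (h : ∀ w, ContMDiffAt I 𝓘(ℝ, V) n (fun y => u y w) x) :
    ContMDiffAt I 𝓘(ℝ, W →L[ℝ] V) n u x := by
  let b := Module.finBasis ℝ W
  have hsum : u = fun y => ∑ i,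
      ContinuousLinearMap.smulRightL ℝ W V (b.coord i).toContinuousLinearMap (u y (b i)) := by
    ext y w
    simpa only [map_sum, map_smul, sum_apply, ContinuousLinearMap.smulRightL_apply_apply,
      ContinuousLinearMap.smulRight_apply, LinearMap.coe_toContinuousLinearMap',
      Module.Basis.coord_apply]
      using congrArg (u y) (b.sum_repr w).symm
  rw [hsum]
  exact contMDiffAt_finsetSum fun i _ =>
    (ContinuousLinearMap.contMDiff _).contMDiffAt.comp x (h (b i))

lemma eventually_contMDiffAt_clm_comp_extChartAt [IsManifold I ∞ M] (β : E →L[ℝ] ℝ) (x : M) :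
    ∀ᶠ y in 𝓝 x, ContMDiffAt I 𝓘(ℝ, ℝ) ∞ (β ∘ extChartAt I x) y := by
  filter_upwards [chart_source_mem_nhds H x] with y hy
  exact β.contMDiff.contMDiffAt.comp y (contMDiffAt_extChartAt' hy)

lemma mvfderiv_clm_comp_extChartAt [IsManifold I 1 M] (β : E →L[ℝ] ℝ) {x y : M}
    (hy : y ∈ (chartAt H x).source) :
    mvfderiv I (β ∘ extChartAt I x) y =
      β.comp ((trivializationAt E (TangentSpace I) x).continuousLinearMapAt ℝ y) := by
  have hchain := mfderiv_comp y β.mdifferentiableAt (mdifferentiableAt_extChartAt (I := I) hy)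
  rw [ContinuousLinearMap.mfderiv_eq,
    ← TangentBundle.continuousLinearMapAt_trivializationAt hy] at hchain
  ext v
  exact congrArg (fun L : E →L[ℝ] ℝ => L v) hchain

lemma cotangent_trivializationAt_symmL [IsManifold I 1 M] (α : E →L[ℝ] ℝ) {x y : M}
    (hy : y ∈ (chartAt H x).source) :
    (trivializationAt (E →L[ℝ] ℝ) (fun x : M => TangentSpace I x →L[ℝ] Trivial M ℝ x) x).symmL
      ℝ y α = α.comp ((trivializationAt E (TangentSpace I) x).continuousLinearMapAt ℝ y) := by
  have hy' : y ∈ (trivializationAt E (TangentSpace I) x).baseSet ∩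
      (trivializationAt ℝ (Trivial M ℝ) x).baseSet := ⟨by simpa using hy, mem_univ _⟩
  rw [Trivialization.symmL_apply (hb := hy')]
  refine (Pretrivialization.continuousLinearMap_symm_apply' (RingHom.id ℝ) _ _ hy' α).trans ?_
  ext v
  simp only [Trivial.fiberBundle_trivializationAt', Trivial.symmL_trivialization,
    ContinuousLinearMap.id_comp, ContinuousLinearMap.comp_apply]

variable [FiniteDimensional ℝ E] [IsManifold I ∞ M]

lemma smoothVec_of_coordinates {X : Vec I M}
    (h : ∀ (x : M) (β : E →L[ℝ] ℝ), ContMDiffAt I 𝓘(ℝ, ℝ) ∞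
      (fun y => mvfderiv I (β ∘ extChartAt I x) y (X y)) x) : SmoothVec I X := by
  intro x
  have : IsManifold I 1 M := IsManifold.of_le (n := ∞) (by simp)
  refine contMDiffAt_totalSpace.2
    ⟨contMDiffAt_id, contMDiffAt_of_forall_dual fun β => (h x β).congr_of_eventuallyEq ?_⟩
  filter_upwards [chart_source_mem_nhds H x] with y hy
  have hy' : y ∈ (trivializationAt E (TangentSpace I) x).baseSet := by simpa using hy
  rw [mvfderiv_clm_comp_extChartAt β hy]
  exact congrArg β (congrFun (Trivialization.coe_linearMapAt_of_mem (R := ℝ) _ hy') (X y)).symm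

lemma isBivector_of_coordinates {Λ : Biv I M}
    (hskew : ∀ (x : M) (a b : TangentSpace I x →L[ℝ] ℝ), b (Λ x a) = -a (Λ x b))
    (h : ∀ (x : M) (α β : E →L[ℝ] ℝ), ContMDiffAt I 𝓘(ℝ, ℝ) ∞
      (fun y => mvfderiv I (β ∘ extChartAt I x) y (Λ y (mvfderiv I (α ∘ extChartAt I x) y))) x) :
    IsBivector I Λ := by
  refine ⟨fun x => ?_, hskew⟩
  have : IsManifold I 1 M := IsManifold.of_le (n := ∞) (by simp)
  rw [contMDiffAt_hom_bundle]
  refine ⟨contMDiffAt_id, contMDiffAt_clm_of_forall_apply fun α =>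
    contMDiffAt_of_forall_dual fun β => (h x α β).congr_of_eventuallyEq ?_⟩
  filter_upwards [chart_source_mem_nhds H x] with y hy
  rw [mvfderiv_clm_comp_extChartAt β hy, mvfderiv_clm_comp_extChartAt α hy,
    ContinuousLinearMap.inCoordinates]
  simp only [ContinuousLinearMap.comp_apply]
  rw [cotangent_trivializationAt_symmL α hy]

end Coordinates

section Extension

variable [FiniteDimensional ℝ E] [IsManifold I ∞ M] [T2Space M] {x : M}

lemma exists_smoothFun_eventuallyEq {u : M → ℝ} (hu : ∀ᶠ y in 𝓝 x, ContMDiffAt I 𝓘(ℝ, ℝ) ∞ u y) :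
    ∃ v : M → ℝ, SmoothFun I v ∧ v =ᶠ[𝓝 x] u := by
  obtain ⟨φ, -, hφ⟩ := (SmoothBumpFunction.nhds_basis_tsupport (I := I) x).mem_iff.1 hu
  refine ⟨fun y => φ y • u y, contMDiff_of_tsupport fun y hy =>
    φ.contMDiffAt.smul (hφ (tsupport_smul_subset_left _ _ hy)), ?_⟩
  filter_upwards [φ.eventuallyEq_one] with y hy
  simp [hy]

lemma exists_smoothFun_mvfderiv_eq (a : TangentSpace I x →L[ℝ] ℝ) :
    ∃ f : M → ℝ, SmoothFun I f ∧ mvfderiv I f x = a := by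
  let b : E →L[ℝ] ℝ := a
  obtain ⟨f, hf, hfb⟩ :=
    exists_smoothFun_eventuallyEq (eventually_contMDiffAt_clm_comp_extChartAt (I := I) b x)
  refine ⟨f, hf, ?_⟩
  have : IsManifold I 1 M := IsManifold.of_le (n := ∞) (by simp)
  have hchain := mvfderiv_comp x b.mdifferentiableAt
    (mdifferentiableAt_extChartAt (I := I) (mem_chart_source H x))
  rw [mfderiv_extChartAt_self] at hchain
  rw [mvfderiv_congr hfb, hchain]
  ext v
  exact congrArg (fun L : E →L[ℝ] ℝ => L v) b.mfderiv_eq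

lemma tangentVector_eq_of_forall_mvfderiv_eq {v w : TangentSpace I x}
    (h : ∀ f : M → ℝ, SmoothFun I f → mvfderiv I f x v = mvfderiv I f x w) : v = w := by
  refine (SeparatingDual.eq_iff_forall_dual_eq (R := ℝ) (V := E)).2 fun a => ?_
  obtain ⟨f, hf, rfl⟩ := exists_smoothFun_mvfderiv_eq (I := I) (x := x) a
  exact h f hf

end Extension

end SmoothTensors

/-! ### The Jacobi identity -/

section FunctionBrackets

variable {E : Type*} [NormedAddCommGroup E] [NormedSpace ℝ E]
  {H : Type*} [TopologicalSpace H] {I : ModelWithCorners ℝ E H}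
  {M : Type*} [TopologicalSpace M] [ChartedSpace H M]
  {Λ : Biv I M} {V X Y : Vec I M} {f g h : M → ℝ}

/-- The derivative `X f` of a function along a vector field. -/
noncomputable def lieFun (X : Vec I M) (f : M → ℝ) : M → ℝ := fun x => mvfderiv I f x (X x)

/-- The Hamiltonian vector field `Λ df`. -/
noncomputable def hamiltonian (Λ : Biv I M) (f : M → ℝ) : Vec I M := sharp I Λ (mvfderiv I f)

/-- The function `Λ(df, dg)`, encoded as the derivative of `g` along `Λ df`. -/
noncomputable def diffBracket (Λ : Biv I M) (f g : M → ℝ) : M → ℝ := lieFun (hamiltonian Λ f) g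

lemma SmoothFun.add (hf : SmoothFun I f) (hg : SmoothFun I g) :
    SmoothFun I (fun y => f y + g y) := ContMDiff.add hf hg

lemma SmoothFun.sub (hf : SmoothFun I f) (hg : SmoothFun I g) :
    SmoothFun I (fun y => f y - g y) := ContMDiff.sub hf hg

lemma SmoothFun.mul (hf : SmoothFun I f) (hg : SmoothFun I g) :
    SmoothFun I (fun y => f y * g y) := ContMDiff.mul hf hg

lemma smoothFun_const (c : ℝ) : SmoothFun I (fun _ : M => c) := contMDiff_const

lemma mvfderiv_fun_mul (hf : SmoothFun I f) (hg : SmoothFun I g) (x : M) :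
    mvfderiv I (fun y => f y * g y) x = f x • mvfderiv I g x + g x • mvfderiv I f x :=
  mvfderiv_mul (hf.mdifferentiableAt x) (hg.mdifferentiableAt x)

lemma lieFun_add (hf : SmoothFun I f) (hg : SmoothFun I g) (x : M) :
    lieFun X (fun y => f y + g y) x = lieFun X f x + lieFun X g x :=
  congrArg (fun L : E →L[ℝ] ℝ => L (X x))
    (mvfderiv_add (hf.mdifferentiableAt x) (hg.mdifferentiableAt x))

lemma lieFun_sub (hf : SmoothFun I f) (hg : SmoothFun I g) (x : M) :
    lieFun X (fun y => f y - g y) x = lieFun X f x - lieFun X g x :=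
  congrArg (fun L : E →L[ℝ] ℝ => L (X x))
    (mvfderiv_sub (hf.mdifferentiableAt x) (hg.mdifferentiableAt x))

lemma lieFun_mul (hf : SmoothFun I f) (hg : SmoothFun I g) (x : M) :
    lieFun X (fun y => f y * g y) x = f x * lieFun X g x + g x * lieFun X f x :=
  congrArg (fun L : E →L[ℝ] ℝ => L (X x)) (mvfderiv_fun_mul hf hg x)

lemma lieFun_neg (x : M) : lieFun X (fun y => - f y) x = - lieFun X f x :=
  congrArg (fun L : E →L[ℝ] ℝ => L (X x)) (mvfderiv_neg (I := I) (g := f) (x := x))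

lemma lieFun_const (X : Vec I M) (c : ℝ) : lieFun X (fun _ => c) = fun _ => 0 :=
  funext fun x => congrArg (fun L : E →L[ℝ] ℝ => L (X x)) (mvfderiv_const (I := I) (x := x) c)

lemma diffBracket_const_left (Λ : Biv I M) (c : ℝ) (f : M → ℝ) :
    diffBracket Λ (fun _ => c) f = fun _ => 0 := by
  funext x
  simp only [diffBracket, lieFun, hamiltonian, sharp, mvfderiv_const, map_zero]

lemma lieFun_hamiltonian (Λ : Biv I M) (f g : M → ℝ) :
    lieFun (hamiltonian Λ f) g = diffBracket Λ f g := rfl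

lemma mvfderiv_eq_lieFun (X : Vec I M) (f : M → ℝ) (x : M) :
    mvfderiv I f x (X x) = lieFun X f x := rfl

lemma bracket_apply (Λ : Biv I M) (V : Vec I M) (f g : M → ℝ) (x : M) : bracket I Λ V f g x =
    diffBracket Λ f g x + (f x * lieFun V g x - g x * lieFun V f x) := rfl

variable [IsManifold I ∞ M]

lemma SmoothFun.lieFun (hf : SmoothFun I f) (hX : SmoothVec I X) : SmoothFun I (lieFun X f) :=
  hf.smoothFun_mvfderiv hX

lemma IsBivector.smoothVec_hamiltonian (hΛ : IsBivector I Λ) (hf : SmoothFun I f) :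
    SmoothVec I (hamiltonian Λ f) := hΛ.smoothVec_sharp hf.smoothForm

lemma IsBivector.smoothFun_diffBracket (hΛ : IsBivector I Λ) (hf : SmoothFun I f)
    (hg : SmoothFun I g) : SmoothFun I (diffBracket Λ f g) :=
  hg.lieFun (hΛ.smoothVec_hamiltonian hf)

lemma IsBivector.diffBracket_swap (hΛ : IsBivector I Λ) (f g : M → ℝ) :
    diffBracket Λ f g = fun x => - diffBracket Λ g f x :=
  funext fun x => hΛ.skew x _ _

lemma lieFun_mlieBracket [CompleteSpace E] (hf : SmoothFun I f) (hX : SmoothVec I X)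
    (hY : SmoothVec I Y) (x : M) :
    lieFun (mlieBracket I X Y) f x = lieFun X (lieFun Y f) x - lieFun Y (lieFun X f) x :=
  mvfderiv_mlieBracket hf hX hY x

lemma lieFun_bracket (hΛ : IsBivector I Λ) (hV : SmoothVec I V) (hf : SmoothFun I f)
    (hg : SmoothFun I g) (x : M) :
    lieFun X (bracket I Λ V f g) x = lieFun X (diffBracket Λ f g) x
      + (f x * lieFun X (lieFun V g) x + lieFun V g x * lieFun X f x)
      - (g x * lieFun X (lieFun V f) x + lieFun V f x * lieFun X g x) := by
  have hfg := hf.mul (hg.lieFun hV)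
  have hgf := hg.mul (hf.lieFun hV)
  have hbracket : bracket I Λ V f g = fun y => diffBracket Λ f g y
      + (f y * lieFun V g y - g y * lieFun V f y) := rfl
  rw [hbracket, lieFun_add (hΛ.smoothFun_diffBracket hf hg) (hfg.sub hgf), lieFun_sub hfg hgf,
    lieFun_mul hf (hg.lieFun hV), lieFun_mul hg (hf.lieFun hV)]
  ring

lemma IsBivector.smoothFun_bracket (hΛ : IsBivector I Λ) (hV : SmoothVec I V) (hf : SmoothFun I f)
    (hg : SmoothFun I g) : SmoothFun I (bracket I Λ V f g) :=
  (hΛ.smoothFun_diffBracket hf hg).add ((hf.mul (hg.lieFun hV)).sub (hg.mul (hf.lieFun hV)))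

end FunctionBrackets

section JacobiIdentity

variable {E : Type*} [NormedAddCommGroup E] [NormedSpace ℝ E]
  {H : Type*} [TopologicalSpace H] {I : ModelWithCorners ℝ E H}
  {M : Type*} [TopologicalSpace M] [ChartedSpace H M]
  {Λ : Biv I M} {V : Vec I M} {f g h : M → ℝ}

/-- The trivector `½[Λ, Λ] + V ∧ Λ`, up to sign, on exact forms: the part of the Jacobiator of
the bracket of `(Λ, V)` in which `f`, `g`, `h` enter only through their differentials. -/
noncomputable def schoutenDefect (Λ : Biv I M) (V : Vec I M) (f g h : M → ℝ) (x : M) : ℝ :=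
  diffBracket Λ f (diffBracket Λ g h) x + diffBracket Λ g (diffBracket Λ h f) x
    + diffBracket Λ h (diffBracket Λ f g) x + lieFun V f x * diffBracket Λ g h x
    + lieFun V g x * diffBracket Λ h f x + lieFun V h x * diffBracket Λ f g x

/-- The function `[V, Λ](df, dg)`, which measures the failure of `V` to preserve `Λ`. -/
noncomputable def lieDefect (Λ : Biv I M) (V : Vec I M) (f g : M → ℝ) (x : M) : ℝ :=
  lieFun V (diffBracket Λ f g) x - diffBracket Λ (lieFun V f) g x - diffBracket Λ f (lieFun V g) x

/-- The identity `[Λdf, Λdg] = Λ d(Λ(df, dg)) - (Vf Λdg - Vg Λdf + Λ(df, dg) V)`, which expresses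
`[Λ, Λ] = -2 V ∧ Λ` (up to the sign convention) through Hamiltonian vector fields. -/
def SchoutenIdentity (Λ : Biv I M) (V : Vec I M) : Prop :=
  ∀ f g : M → ℝ, SmoothFun I f → SmoothFun I g → ∀ x,
    mlieBracket I (hamiltonian Λ f) (hamiltonian Λ g) x = hamiltonian Λ (diffBracket Λ f g) x
      - (lieFun V f x • hamiltonian Λ g x - lieFun V g x • hamiltonian Λ f x
        + diffBracket Λ f g x • V x)

/-- The identity `[V, Λdf] = Λ d(Vf)`, which expresses `[V, Λ] = 0` through Hamiltonian vector
fields. -/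
def Preserves (V : Vec I M) (Λ : Biv I M) : Prop :=
  ∀ f : M → ℝ, SmoothFun I f → ∀ x,
    mlieBracket I V (hamiltonian Λ f) x = hamiltonian Λ (lieFun V f) x

lemma schoutenDefect_cycle (Λ : Biv I M) (V : Vec I M) (f g h : M → ℝ) (x : M) :
    schoutenDefect Λ V f g h x = schoutenDefect Λ V g h f x := by
  simp only [schoutenDefect]
  ring

variable [IsManifold I ∞ M]

lemma jacobiator_bracket (hΛ : IsBivector I Λ) (hV : SmoothVec I V)
    (hf : SmoothFun I f) (hg : SmoothFun I g) (hh : SmoothFun I h) (x : M) :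
    bracket I Λ V f (bracket I Λ V g h) x + bracket I Λ V g (bracket I Λ V h f) x
      + bracket I Λ V h (bracket I Λ V f g) x =
    schoutenDefect Λ V f g h x + f x * lieDefect Λ V g h x + g x * lieDefect Λ V h f x
      + h x * lieDefect Λ V f g x := by
  have swap (u v : M → ℝ) := congrFun (hΛ.diffBracket_swap u v) x
  simp only [bracket_apply, ← lieFun_hamiltonian Λ _ (bracket I Λ V _ _),
    lieFun_bracket hΛ hV hg hh, lieFun_bracket hΛ hV hh hf, lieFun_bracket hΛ hV hf hg]
  simp only [lieFun_hamiltonian, schoutenDefect, lieDefect]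
  rw [swap g f, swap h f, swap h g, swap (lieFun V g) h, swap (lieFun V h) f, swap (lieFun V f) g]
  ring

lemma IsJacobi.lieDefect_eq_zero (hJ : IsJacobi I Λ V) (hf : SmoothFun I f) (hg : SmoothFun I g)
    (x : M) : lieDefect Λ V f g x = 0 := by
  -- The Jacobi identity for `1, f, g`: every other term differentiates the constant `1`.
  have hone : SmoothFun I (fun _ : M => (1 : ℝ)) := smoothFun_const 1
  have hjac := hJ.jacobi _ f g hone hf hg x
  have hright (u : M → ℝ) (c : ℝ) : diffBracket Λ u (fun _ => c) = fun _ => 0 := lieFun_const _ c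
  rw [jacobiator_bracket hJ.isBivector hJ.smoothVec hone hf hg] at hjac
  simpa only [schoutenDefect, lieDefect, diffBracket_const_left, lieFun_const, hright, one_mul,
    zero_mul, mul_zero, add_zero, zero_add, sub_zero] using hjac

lemma isJacobi_iff_defects : IsJacobi I Λ V ↔ IsBivector I Λ ∧ SmoothVec I V ∧
    (∀ f g h : M → ℝ, SmoothFun I f → SmoothFun I g → SmoothFun I h → ∀ x,
      schoutenDefect Λ V f g h x = 0) ∧
    (∀ f g : M → ℝ, SmoothFun I f → SmoothFun I g → ∀ x, lieDefect Λ V f g x = 0) := by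
  constructor
  · intro hJ
    refine ⟨hJ.isBivector, hJ.smoothVec, fun f g h hf hg hh x => ?_,
      fun f g hf hg => hJ.lieDefect_eq_zero hf hg⟩
    have hjac := hJ.jacobi f g h hf hg hh x
    rw [jacobiator_bracket hJ.isBivector hJ.smoothVec hf hg hh, hJ.lieDefect_eq_zero hg hh,
      hJ.lieDefect_eq_zero hh hf, hJ.lieDefect_eq_zero hf hg] at hjac
    simpa only [mul_zero, add_zero] using hjac
  · rintro ⟨hΛ, hV, hschouten, hlie⟩
    refine ⟨hΛ, hV, fun f g h hf hg hh x => ?_⟩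
    rw [jacobiator_bracket hΛ hV hf hg hh, hschouten f g h hf hg hh, hlie g h hg hh,
      hlie h f hh hf, hlie f g hf hg]
    ring

lemma schoutenDefect_eq [CompleteSpace E] (hΛ : IsBivector I Λ)
    (hf : SmoothFun I f) (hg : SmoothFun I g) (hh : SmoothFun I h) (x : M) :
    schoutenDefect Λ V f g h x =
      mvfderiv I h x (mlieBracket I (hamiltonian Λ f) (hamiltonian Λ g) x) -
        mvfderiv I h x (hamiltonian Λ (diffBracket Λ f g) x - (lieFun V f x • hamiltonian Λ g x
          - lieFun V g x • hamiltonian Λ f x + diffBracket Λ f g x • V x)) := by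
  have hbr := lieFun_mlieBracket hh (hΛ.smoothVec_hamiltonian hf) (hΛ.smoothVec_hamiltonian hg) x
  have hneg : diffBracket Λ g (diffBracket Λ h f) x = - diffBracket Λ g (diffBracket Λ f h) x := by
    rw [hΛ.diffBracket_swap h f]
    exact lieFun_neg x
  simp only [map_sub, map_add, map_smul, smul_eq_mul, mvfderiv_eq_lieFun, hbr, lieFun_hamiltonian,
    schoutenDefect, hneg]
  rw [congrFun (hΛ.diffBracket_swap h (diffBracket Λ f g)) x, congrFun (hΛ.diffBracket_swap h f) x]
  ring

lemma schoutenDefect_congr [CompleteSpace E] {f' g' h' : M → ℝ} {x : M} (hΛ : IsBivector I Λ)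
    (hf : SmoothFun I f) (hg : SmoothFun I g) (hh : SmoothFun I h)
    (hf' : SmoothFun I f') (hg' : SmoothFun I g') (hh' : SmoothFun I h')
    (hff' : mvfderiv I f x = mvfderiv I f' x) (hgg' : mvfderiv I g x = mvfderiv I g' x)
    (hhh' : mvfderiv I h x = mvfderiv I h' x) :
    schoutenDefect Λ V f g h x = schoutenDefect Λ V f' g' h' x := by
  rw [schoutenDefect_eq hΛ hf hg hh, hhh', ← schoutenDefect_eq hΛ hf hg hh', schoutenDefect_cycle,
    schoutenDefect_eq hΛ hg hh' hf, hff', ← schoutenDefect_eq hΛ hg hh' hf', schoutenDefect_cycle,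
    schoutenDefect_eq hΛ hh' hf' hg, hgg', ← schoutenDefect_eq hΛ hh' hf' hg', schoutenDefect_cycle]

lemma lieDefect_eq [CompleteSpace E] (hΛ : IsBivector I Λ) (hV : SmoothVec I V)
    (hf : SmoothFun I f) (hg : SmoothFun I g) (x : M) :
    lieDefect Λ V f g x = mvfderiv I g x (mlieBracket I V (hamiltonian Λ f) x) -
      mvfderiv I g x (hamiltonian Λ (lieFun V f) x) := by
  have hbr := lieFun_mlieBracket hg hV (hΛ.smoothVec_hamiltonian hf) x
  simp only [mvfderiv_eq_lieFun, hbr, lieFun_hamiltonian, lieDefect]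
  ring

variable [FiniteDimensional ℝ E] [T2Space M]

lemma schoutenIdentity_iff (hΛ : IsBivector I Λ) :
    SchoutenIdentity Λ V ↔ ∀ f g h : M → ℝ, SmoothFun I f → SmoothFun I g → SmoothFun I h → ∀ x,
      schoutenDefect Λ V f g h x = 0 := by
  have : CompleteSpace E := FiniteDimensional.complete ℝ E
  refine ⟨fun hS f g h hf hg hh x => ?_, fun hS f g hf hg x =>
    tangentVector_eq_of_forall_mvfderiv_eq fun h hh => ?_⟩
  · rw [schoutenDefect_eq hΛ hf hg hh, hS f g hf hg, sub_self]
  · exact sub_eq_zero.1 ((schoutenDefect_eq hΛ hf hg hh x).symm.trans (hS f g h hf hg hh x))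

lemma preserves_iff (hΛ : IsBivector I Λ) (hV : SmoothVec I V) :
    Preserves V Λ ↔
      ∀ f g : M → ℝ, SmoothFun I f → SmoothFun I g → ∀ x, lieDefect Λ V f g x = 0 := by
  have : CompleteSpace E := FiniteDimensional.complete ℝ E
  refine ⟨fun hS f g hf hg x => ?_, fun hS f hf x =>
    tangentVector_eq_of_forall_mvfderiv_eq fun g hg => ?_⟩
  · rw [lieDefect_eq hΛ hV hf hg, hS f hf, sub_self]
  · exact sub_eq_zero.1 ((lieDefect_eq hΛ hV hf hg x).symm.trans (hS f g hf hg x))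

theorem isJacobi_iff : IsJacobi I Λ V ↔
    IsBivector I Λ ∧ SmoothVec I V ∧ SchoutenIdentity Λ V ∧ Preserves V Λ := by
  rw [isJacobi_iff_defects]
  refine and_congr_right fun hΛ => and_congr_right fun hV => ?_
  rw [schoutenIdentity_iff hΛ, preserves_iff hΛ hV]

end JacobiIdentity

section SmoothnessCriteria

variable {E : Type*} [NormedAddCommGroup E] [NormedSpace ℝ E] [FiniteDimensional ℝ E]
  {H : Type*} [TopologicalSpace H] {I : ModelWithCorners ℝ E H}
  {M : Type*} [TopologicalSpace M] [ChartedSpace H M] [IsManifold I ∞ M] [T2Space M]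

lemma isBivector_of_smoothFun_diffBracket {Λ : Biv I M}
    (hskew : ∀ (x : M) (a b : TangentSpace I x →L[ℝ] ℝ), b (Λ x a) = -a (Λ x b))
    (h : ∀ f g : M → ℝ, SmoothFun I f → SmoothFun I g → SmoothFun I (diffBracket Λ f g)) :
    IsBivector I Λ := by
  refine isBivector_of_coordinates hskew fun x α β => ?_
  obtain ⟨f, hf, hfα⟩ := exists_smoothFun_eventuallyEq
    (eventually_contMDiffAt_clm_comp_extChartAt (I := I) α x)
  obtain ⟨g, hg, hgβ⟩ := exists_smoothFun_eventuallyEq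
    (eventually_contMDiffAt_clm_comp_extChartAt (I := I) β x)
  refine (h f g hf hg x).congr_of_eventuallyEq ?_
  filter_upwards [hfα.eventuallyEq_nhds, hgβ.eventuallyEq_nhds] with y hfy hgy
  rw [← mvfderiv_congr hfy, ← mvfderiv_congr hgy]
  rfl

lemma smoothVec_of_smoothFun_lieFun {X : Vec I M}
    (h : ∀ f : M → ℝ, SmoothFun I f → SmoothFun I (lieFun X f)) : SmoothVec I X := by
  refine smoothVec_of_coordinates fun x β => ?_
  obtain ⟨f, hf, hfβ⟩ := exists_smoothFun_eventuallyEq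
    (eventually_contMDiffAt_clm_comp_extChartAt (I := I) β x)
  refine (h f hf x).congr_of_eventuallyEq ?_
  filter_upwards [hfβ.eventuallyEq_nhds] with y hfy
  rw [← mvfderiv_congr hfy]
  rfl

end SmoothnessCriteria

/-! ### Nijenhuis tensors -/

section Endomorphisms

variable {E : Type*} [NormedAddCommGroup E] [NormedSpace ℝ E]
  {H : Type*} [TopologicalSpace H] {I : ModelWithCorners ℝ E H}
  {M : Type*} [TopologicalSpace M] [ChartedSpace H M]
  {Λ : Biv I M} {J K : Endo I M} {X Y : Vec I M}

section Powers

lemma power_zero (J : Endo I M) :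
    power I J 0 = fun x => ContinuousLinearMap.id ℝ (TangentSpace I x) :=
  funext fun x => pow_zero (J x)

lemma power_succ (J : Endo I M) (k : ℕ) :
    power I J (k + 1) = fun x => (J x).comp (power I J k x) :=
  funext fun x => pow_succ' (J x) k

lemma power_succ' (J : Endo I M) (k : ℕ) :
    power I J (k + 1) = fun x => (power I J k x).comp (J x) :=
  funext fun x => pow_succ (J x) k

lemma power_zero_apply (J : Endo I M) (x : M) (v : TangentSpace I x) : power I J 0 x v = v := by
  rw [power_zero, ContinuousLinearMap.id_apply]

lemma power_succ_apply (J : Endo I M) (k : ℕ) (x : M) (v : TangentSpace I x) :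
    power I J (k + 1) x v = J x (power I J k x v) := by
  rw [power_succ, ContinuousLinearMap.comp_apply]

lemma app_power_zero (J : Endo I M) (X : Vec I M) : app I (power I J 0) X = X :=
  funext fun x => power_zero_apply J x _

lemma app_power_succ (J : Endo I M) (k : ℕ) (X : Vec I M) :
    app I (power I J (k + 1)) X = app I J (app I (power I J k) X) :=
  funext fun x => power_succ_apply J k x _

lemma comp_power_zero (J : Endo I M) (Λ : Biv I M) : comp I (power I J 0) Λ = Λ :=
  funext fun x => by ext1 a; exact power_zero_apply J x _

lemma comp_power_succ (J : Endo I M) (k : ℕ) (Λ : Biv I M) :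
    comp I (power I J (k + 1)) Λ = comp I J (comp I (power I J k) Λ) :=
  funext fun x => by ext1 a; exact power_succ_apply J k x _

end Powers

section Commuting

lemma Commutes.sharp_transp (hc : Commutes I J Λ) (α : Form I M) :
    sharp I Λ (transp I J α) = app I J (sharp I Λ α) :=
  funext fun x => (hc x (α x)).symm

lemma Commutes.pair_transp_left (hc : Commutes I J Λ) (α β : Form I M) :
    pair I Λ (transp I J α) β = pair I (comp I J Λ) α β :=
  funext fun x => congrArg (β x) (hc x (α x)).symm

lemma Commutes.comp_endo (hc : Commutes I J Λ) : Commutes I J (comp I J Λ) := fun x a =>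
  congrArg (J x) (hc x a)

lemma Commutes.power (hc : Commutes I J Λ) (k : ℕ) : Commutes I (power I J k) Λ := by
  intro x a
  induction k generalizing a with
  | zero => rw [power_zero]; rfl
  | succ k ih =>
    rw [power_succ', ContinuousLinearMap.comp_apply, hc, ih, ← power_succ', power_succ]
    rfl

lemma Commutes.comp_power (hc : Commutes I J Λ) (k : ℕ) :
    Commutes I J (comp I (JacobiNijenhuis.power I J k) Λ) := by
  induction k with
  | zero => rwa [comp_power_zero]
  | succ k ih => rw [comp_power_succ]; exact ih.comp_endo

lemma Commutes.comp_skew [IsManifold I ∞ M] (hc : Commutes I J Λ) (hΛ : IsBivector I Λ) (x : M)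
    (a b : TangentSpace I x →L[ℝ] ℝ) : b (comp I J Λ x a) = - a (comp I J Λ x b) :=
  (hΛ.skew x a (b.comp (J x))).trans (congrArg (fun v => - a v) (hc x b).symm)

end Commuting

section Smoothness

variable [IsManifold I ∞ M]

lemma smoothEndo_id : SmoothEndo I (fun x : M => ContinuousLinearMap.id ℝ (TangentSpace I x)) := by
  intro x
  rw [contMDiffAt_hom_bundle]
  refine ⟨contMDiffAt_id,
    (contMDiffAt_const (c := ContinuousLinearMap.id ℝ E)).congr_of_eventuallyEq ?_⟩
  filter_upwards [chart_source_mem_nhds H x] with y hy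
  have hy' : y ∈ (trivializationAt E (TangentSpace I) x).baseSet := by simpa using hy
  ext v
  exact Trivialization.continuousLinearMapAt_symmL (R := ℝ) _ hy' v

lemma SmoothEndo.comp (hJ : SmoothEndo I J) (hK : SmoothEndo I K) :
    SmoothEndo I (fun x => (J x).comp (K x)) := by
  intro x
  have hJx := hJ x
  have hKx := hK x
  rw [contMDiffAt_hom_bundle] at hJx hKx ⊢
  refine ⟨contMDiffAt_id, (hJx.2.clm_comp hKx.2).congr_of_eventuallyEq ?_⟩
  filter_upwards [chart_source_mem_nhds H x] with y hy
  have hy' : y ∈ (trivializationAt E (TangentSpace I) x).baseSet := by simpa using hy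
  ext v
  simp only [ContinuousLinearMap.inCoordinates, ContinuousLinearMap.comp_apply]
  rw [(trivializationAt E (TangentSpace I) x).symmL_continuousLinearMapAt hy']

lemma SmoothEndo.power (hJ : SmoothEndo I J) (k : ℕ) : SmoothEndo I (power I J k) := by
  induction k with
  | zero => rw [power_zero]; exact smoothEndo_id
  | succ k ih => rw [power_succ]; exact hJ.comp ih

lemma SmoothEndo.sub_smul (hJ : SmoothEndo I J) (hK : SmoothEndo I K) (c : ℝ) :
    SmoothEndo I (fun x => J x - c • K x) :=
  ContMDiff.sub_section hJ (ContMDiff.const_smul_section hK)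

lemma IsBivector.comp_endo [FiniteDimensional ℝ E] [T2Space M] (hΛ : IsBivector I Λ)
    (hJ : SmoothEndo I J) (hc : Commutes I J Λ) : IsBivector I (comp I J Λ) :=
  isBivector_of_smoothFun_diffBracket (hc.comp_skew hΛ) fun _ _ hf hg =>
    hg.lieFun (hJ.smoothVec_app (hΛ.smoothVec_hamiltonian hf))

end Smoothness

section NijenhuisTensors

/-- The vector field `(L_Y J) X = [Y, J X] - J [Y, X]`. -/
noncomputable def lieEndo (Y : Vec I M) (J : Endo I M) (X : Vec I M) : Vec I M := fun x =>
  mlieBracket I Y (app I J X) x - J x (mlieBracket I Y X x)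

lemma lieEndo_power_succ (Y : Vec I M) (J : Endo I M) (k : ℕ) (X : Vec I M) (x : M) :
    lieEndo Y (power I J (k + 1)) X x =
      lieEndo Y J (app I (power I J k) X) x + J x (lieEndo Y (power I J k) X x) := by
  simp only [lieEndo, app_power_succ, power_succ_apply, map_sub]
  abel

lemma torsion_eq (J : Endo I M) (X Y : Vec I M) (x : M) :
    torsion I J X Y x = lieEndo (app I J X) J Y x - J x (lieEndo X J Y x) := by
  simp only [torsion, lieEndo, map_sub]
  abel

variable [IsManifold I ∞ M]

lemma IsNijenhuis.lieEndo_app (hJ : IsNijenhuis I J) (hX : SmoothVec I X) (hY : SmoothVec I Y)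
    (x : M) : lieEndo (app I J X) J Y x = J x (lieEndo X J Y x) :=
  sub_eq_zero.1 ((torsion_eq J X Y x).symm.trans (hJ.torsion_eq_zero X Y hX hY x))

lemma IsNijenhuis.lieEndo_app_power_right (hJ : IsNijenhuis I J) (hX : SmoothVec I X)
    (hY : SmoothVec I Y) (k : ℕ) (x : M) :
    lieEndo (app I J X) (power I J k) Y x = J x (lieEndo X (power I J k) Y x) := by
  induction k with
  | zero => simp only [lieEndo, app_power_zero, power_zero_apply, sub_self, map_zero]
  | succ k ih =>
    rw [lieEndo_power_succ, lieEndo_power_succ, map_add, ih,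
      hJ.lieEndo_app hX ((hJ.smooth.power k).smoothVec_app hY)]

lemma IsNijenhuis.lieEndo_app_power (hJ : IsNijenhuis I J) (hX : SmoothVec I X)
    (hY : SmoothVec I Y) (k l : ℕ) (x : M) :
    lieEndo (app I (power I J k) X) (power I J l) Y x =
      power I J k x (lieEndo X (power I J l) Y x) := by
  induction k with
  | zero => rw [app_power_zero, power_zero_apply]
  | succ k ih =>
    rw [app_power_succ, hJ.lieEndo_app_power_right ((hJ.smooth.power k).smoothVec_app hX) hY, ih,
      power_succ_apply]

lemma isNijenhuis_id :
    IsNijenhuis I (fun x : M => ContinuousLinearMap.id ℝ (TangentSpace I x)) where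
  smooth := smoothEndo_id
  torsion_eq_zero X Y _ _ x := by
    rw [torsion_eq]
    exact sub_self _

end NijenhuisTensors

end Endomorphisms

section LieDerivatives

variable {E : Type*} [NormedAddCommGroup E] [NormedSpace ℝ E] [FiniteDimensional ℝ E]
  {H : Type*} [TopologicalSpace H] {I : ModelWithCorners ℝ E H}
  {M : Type*} [TopologicalSpace M] [ChartedSpace H M] [IsManifold I ∞ M]
  {Λ : Biv I M} {V X : Vec I M} {α β : Form I M} {f g : M → ℝ}

lemma exists_smoothVec_eq [T2Space M] {x : M} (v : TangentSpace I x) :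
    ∃ X : Vec I M, SmoothVec I X ∧ X x = v := by
  obtain ⟨s, hs, hv⟩ := FiberBundle.exists_contMDiffOn_extend (k := ∞) I E v
  obtain ⟨t, hts, ht, hxt⟩ := mem_nhds_iff.1 hs
  obtain ⟨φ, -, hφ⟩ := (SmoothBumpFunction.nhds_basis_tsupport (I := I) x).mem_iff.1
    (ht.mem_nhds hxt)
  refine ⟨fun y => φ y • FiberBundle.extend E v y,
    ContMDiffOn.smul_section_of_tsupport φ.contMDiff.contMDiffOn ht hφ (hv.mono hts), ?_⟩
  simp only [φ.eq_one, one_smul, FiberBundle.extend_apply_self]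

lemma covector_eq_of_forall_smoothVec [T2Space M] {x : M} {a b : TangentSpace I x →L[ℝ] ℝ}
    (h : ∀ X : Vec I M, SmoothVec I X → a (X x) = b (X x)) : a = b := by
  ext v
  obtain ⟨X, hX, rfl⟩ := exists_smoothVec_eq (I := I) v
  exact h X hX

lemma formBracket_apply (Λ : Biv I M) (hα : SmoothForm I α) (hβ : SmoothForm I β)
    (hX : SmoothVec I X) (x : M) :
    formBracket I Λ α β x (X x) =
      lieEval I (sharp I Λ α) β x X - lieEval I (sharp I Λ β) α x X
        - lieFun X (pair I Λ α β) x := by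
  rw [formBracket, _root_.sub_apply, _root_.sub_apply, lieForm_apply I hβ hX,
    lieForm_apply I hα hX]
  rfl

variable [T2Space M]

lemma lieForm_mvfderiv (hX : SmoothVec I X) (hf : SmoothFun I f) (x : M) :
    lieForm I X (mvfderiv I f) x = mvfderiv I (lieFun X f) x := by
  have : CompleteSpace E := FiniteDimensional.complete ℝ E
  refine covector_eq_of_forall_smoothVec fun Y hY => ?_
  rw [lieForm_apply I hf.smoothForm hY, mvfderiv_mlieBracket hf hX hY]
  exact sub_sub_cancel _ _

lemma lieBiv_mvfderiv (Λ : Biv I M) (hX : SmoothVec I X) (hf : SmoothFun I f)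
    (hg : SmoothFun I g) (x : M) :
    lieBiv I X Λ (mvfderiv I f) (mvfderiv I g) x = lieDefect Λ X f g x := by
  simp only [lieBiv, pair, lieForm_mvfderiv hX hf, lieForm_mvfderiv hX hg]
  rfl

lemma formBracket_mvfderiv_right (hΛ : IsBivector I Λ) (hα : SmoothForm I α)
    (hg : SmoothFun I g) (x : M) :
    formBracket I Λ α (mvfderiv I g) x = - lieForm I (hamiltonian Λ g) α x := by
  have hpair : pair I Λ α (mvfderiv I g) = lieFun (sharp I Λ α) g := rfl
  rw [formBracket, lieForm_mvfderiv (hΛ.smoothVec_sharp hα) hg, hpair, sub_right_comm, sub_self,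
    zero_sub]
  rfl

lemma formBracket_mvfderiv_left (hΛ : IsBivector I Λ) (hf : SmoothFun I f)
    (hβ : SmoothForm I β) (x : M) :
    formBracket I Λ (mvfderiv I f) β x = lieForm I (hamiltonian Λ f) β x := by
  have hskew : lieFun (sharp I Λ β) f = -pair I Λ (mvfderiv I f) β :=
    funext fun y => hΛ.skew y _ _
  rw [formBracket, lieForm_mvfderiv (hΛ.smoothVec_sharp hβ) hf, hskew, mvfderiv_neg,
    sub_neg_eq_add, add_sub_cancel_right]
  rfl

lemma formBracket_mvfderiv (hΛ : IsBivector I Λ) (hf : SmoothFun I f) (hg : SmoothFun I g)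
    (x : M) :
    formBracket I Λ (mvfderiv I f) (mvfderiv I g) x = mvfderiv I (diffBracket Λ f g) x := by
  rw [formBracket_mvfderiv_left hΛ hf hg.smoothForm,
    lieForm_mvfderiv (hΛ.smoothVec_hamiltonian hf) hg]
  rfl

lemma SchoutenIdentity.mlieBracket_sharp (hS : SchoutenIdentity Λ V) (hΛ : IsBivector I Λ)
    (hα : SmoothForm I α) (hf : SmoothFun I f) (x : M) :
    mlieBracket I (hamiltonian Λ f) (sharp I Λ α) x = Λ x (lieForm I (hamiltonian Λ f) α x)
      - lieFun V f x • sharp I Λ α x + α x (V x) • hamiltonian Λ f x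
      - α x (hamiltonian Λ f x) • V x := by
  have : CompleteSpace E := FiniteDimensional.complete ℝ E
  refine tangentVector_eq_of_forall_mvfderiv_eq fun g hg => ?_
  have hXf := hΛ.smoothVec_hamiltonian hf
  have hleft := lieFun_mlieBracket hg hXf (hΛ.smoothVec_sharp hα) x
  have hskew : lieFun (sharp I Λ α) g = fun y => - α y (hamiltonian Λ g y) :=
    funext fun y => hΛ.skew y _ _
  have hskew' : lieFun (sharp I Λ α) (diffBracket Λ f g) x =
      - α x (hamiltonian Λ (diffBracket Λ f g) x) := hΛ.skew x _ _
  have hlie := lieForm_apply I (X := hamiltonian Λ f) hα (hΛ.smoothVec_hamiltonian hg) x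
  have hlie' : mvfderiv I g x (Λ x (lieForm I (hamiltonian Λ f) α x)) =
      - lieForm I (hamiltonian Λ f) α x (hamiltonian Λ g x) := hΛ.skew x _ _
  rw [hS f g hf hg] at hlie
  simp only [map_sub, map_add, map_smul, smul_eq_mul, mvfderiv_eq_lieFun, hleft, hlie', hlie,
    hskew, lieFun_neg, lieFun_hamiltonian, hskew']
  ring

end LieDerivatives

section Concomitants

variable {E : Type*} [NormedAddCommGroup E] [NormedSpace ℝ E] [FiniteDimensional ℝ E]
  {H : Type*} [TopologicalSpace H] {I : ModelWithCorners ℝ E H}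
  {M : Type*} [TopologicalSpace M] [ChartedSpace H M] [IsManifold I ∞ M]
  {Λ : Biv I M} {V X : Vec I M} {J : Endo I M} {α β : Form I M} {f g : M → ℝ}

lemma concomitant_apply (hc : Commutes I J Λ) (hJ : SmoothEndo I J) (hα : SmoothForm I α)
    (hβ : SmoothForm I β) (hX : SmoothVec I X) (x : M) :
    concomitant I Λ J α β x (X x) =
      α x (lieEndo (sharp I Λ β) J X x) - β x (lieEndo (sharp I Λ α) J X x)
        + lieFun X (pair I (comp I J Λ) α β) x - lieFun (app I J X) (pair I Λ α β) x := by
  have hJX := hJ.smoothVec_app hX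
  have hJα := hJ.smoothForm_transp hα
  have hJβ := hJ.smoothForm_transp hβ
  have hexpand : concomitant I Λ J α β x (X x) = formBracket I (comp I J Λ) α β x (X x)
      - (formBracket I Λ (transp I J α) β x (X x) + formBracket I Λ α (transp I J β) x (X x)
        - formBracket I Λ α β x (app I J X x)) := rfl
  have hpair : pair I Λ α (transp I J β) = pair I (comp I J Λ) α β := rfl
  have hcomp (γ : Form I M) : sharp I (comp I J Λ) γ = app I J (sharp I Λ γ) := rfl
  rw [hexpand, formBracket_apply _ hα hβ hX, formBracket_apply _ hJα hβ hX,
    formBracket_apply _ hα hJβ hX, formBracket_apply _ hα hβ hJX, hc.sharp_transp, hc.sharp_transp,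
    hc.pair_transp_left, hpair, hcomp, hcomp]
  simp only [lieEval, lieEndo, map_sub, transp, app, ContinuousLinearMap.comp_apply]
  ring

lemma IsNijenhuis.concomitant_power_succ_apply (hJ : IsNijenhuis I J) (hc : Commutes I J Λ)
    (hΛ : IsBivector I Λ) (hα : SmoothForm I α) (hβ : SmoothForm I β) (hX : SmoothVec I X)
    (k : ℕ) (x : M) :
    concomitant I Λ (power I J (k + 1)) α β x (X x) =
      concomitant I Λ J α β x (app I (power I J k) X x)
        + concomitant I Λ (power I J k) α (transp I J β) x (X x) := by
  have hJk := hJ.smooth.power k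
  have hpair (k : ℕ) : pair I (comp I (power I J (k + 1)) Λ) α β =
      pair I (comp I (power I J k) Λ) α (transp I J β) := by
    rw [comp_power_succ]; rfl
  have hpair' : pair I Λ α (transp I J β) = pair I (comp I J Λ) α β := rfl
  have htransp (v : TangentSpace I x) : transp I J β x v = β x (J x v) := rfl
  rw [concomitant_apply (hc.power (k + 1)) (hJ.smooth.power (k + 1)) hα hβ hX,
    concomitant_apply hc hJ.smooth hα hβ (hJk.smoothVec_app hX),
    concomitant_apply (hc.power k) hJk hα (hJ.smooth.smoothForm_transp hβ) hX, hc.sharp_transp,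
    hJ.lieEndo_app_power_right (hΛ.smoothVec_sharp hβ) hX, app_power_succ, hpair, hpair', htransp]
  simp only [lieEndo_power_succ, map_add]
  ring

variable [T2Space M]

lemma IsNijenhuis.concomitant_comp (hJ : IsNijenhuis I J) (hc : Commutes I J Λ)
    (hΛ : IsBivector I Λ) (hα : SmoothForm I α) (hβ : SmoothForm I β) (x : M) :
    concomitant I (comp I J Λ) J α β x = concomitant I Λ J α (transp I J β) x := by
  refine covector_eq_of_forall_smoothVec fun X hX => ?_
  have hcomp (γ : Form I M) : sharp I (comp I J Λ) γ = app I J (sharp I Λ γ) := rfl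
  rw [concomitant_apply hc.comp_endo hJ.smooth hα hβ hX,
    concomitant_apply hc hJ.smooth hα (hJ.smooth.smoothForm_transp hβ) hX, hcomp, hcomp,
    hJ.lieEndo_app (hΛ.smoothVec_sharp hα) hX, hc.sharp_transp]
  rfl

lemma concomitant_mvfderiv (hΛ : IsBivector I Λ) (hJ : SmoothEndo I J) (hc : Commutes I J Λ)
    (hf : SmoothFun I f) (hg : SmoothFun I g) (x : M) :
    concomitant I Λ J (mvfderiv I f) (mvfderiv I g) x =
      mvfderiv I (diffBracket (comp I J Λ) f g) x
        - lieForm I (hamiltonian Λ f) (transp I J (mvfderiv I g)) x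
        + lieForm I (hamiltonian Λ g) (transp I J (mvfderiv I f)) x
        + transp I J (mvfderiv I (diffBracket Λ f g)) x := by
  have hexpand : concomitant I Λ J (mvfderiv I f) (mvfderiv I g) x =
      formBracket I (comp I J Λ) (mvfderiv I f) (mvfderiv I g) x
        - (formBracket I Λ (transp I J (mvfderiv I f)) (mvfderiv I g) x
          + formBracket I Λ (mvfderiv I f) (transp I J (mvfderiv I g)) x
          - (formBracket I Λ (mvfderiv I f) (mvfderiv I g) x).comp (J x)) := rfl
  rw [hexpand, formBracket_mvfderiv (hΛ.comp_endo hJ hc) hf hg, formBracket_mvfderiv hΛ hf hg,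
    formBracket_mvfderiv_right hΛ (hJ.smoothForm_transp hf.smoothForm) hg,
    formBracket_mvfderiv_left hΛ hf (hJ.smoothForm_transp hg.smoothForm), transp]
  abel

end Concomitants

section Hierarchy

variable {E : Type*} [NormedAddCommGroup E] [NormedSpace ℝ E] [FiniteDimensional ℝ E]
  {H : Type*} [TopologicalSpace H] {I : ModelWithCorners ℝ E H}
  {M : Type*} [TopologicalSpace M] [ChartedSpace H M] [IsManifold I ∞ M] [T2Space M]
  {Λ : Biv I M} {V : Vec I M} {J : Endo I M}

/-- The condition `J Λ (C(Λ, J)(α, β)) = Λ(α, β) J² V - Λ(α, ᵗJ β) J V` linking the concomitant of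
`Λ` and `J` to the vector field `V`; for `V = 0` it holds if the concomitant vanishes. -/
def ConcomitantIdentity (Λ : Biv I M) (V : Vec I M) (J : Endo I M) : Prop :=
  ∀ α β : Form I M, SmoothForm I α → SmoothForm I β → ∀ x : M,
    J x (Λ x (concomitant I Λ J α β x)) =
      pair I Λ α β x • J x (J x (V x)) - pair I (comp I J Λ) α β x • J x (V x)

lemma ConcomitantIdentity.comp_endo (hC : ConcomitantIdentity Λ V J) (hΛ : IsBivector I Λ)
    (hJ : IsNijenhuis I J) (hc : Commutes I J Λ) :
    ConcomitantIdentity (comp I J Λ) (app I J V) J := by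
  intro α β hα hβ x
  rw [hJ.concomitant_comp hc hΛ hα hβ]
  exact (congrArg (J x) (hC α _ hα (hJ.smooth.smoothForm_transp hβ) x)).trans (by
    simp only [map_sub, map_smul]; rfl)

lemma SchoutenIdentity.mlieBracket_app_hamiltonian (hS : SchoutenIdentity Λ V)
    (hΛ : IsBivector I Λ) (hJ : SmoothEndo I J) (hc : Commutes I J Λ) {f g : M → ℝ}
    (hf : SmoothFun I f) (hg : SmoothFun I g) (x : M) :
    mlieBracket I (hamiltonian Λ f) (app I J (hamiltonian Λ g)) x =
      Λ x (lieForm I (hamiltonian Λ f) (transp I J (mvfderiv I g)) x)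
        - lieFun V f x • J x (hamiltonian Λ g x) + lieFun (app I J V) g x • hamiltonian Λ f x
        - diffBracket (comp I J Λ) f g x • V x := by
  have h := hS.mlieBracket_sharp hΛ (hJ.smoothForm_transp hg.smoothForm) hf x
  rwa [hc.sharp_transp] at h

lemma SchoutenIdentity.comp_endo (hS : SchoutenIdentity Λ V) (hC : ConcomitantIdentity Λ V J)
    (hΛ : IsBivector I Λ) (hJ : IsNijenhuis I J) (hc : Commutes I J Λ) :
    SchoutenIdentity (comp I J Λ) (app I J V) := by
  intro f g hf hg x
  have hnij := hJ.lieEndo_app (hΛ.smoothVec_hamiltonian hf) (hΛ.smoothVec_hamiltonian hg) x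
  have hswap : diffBracket (comp I J Λ) g f x = - diffBracket (comp I J Λ) f g x :=
    hc.comp_skew hΛ x _ _
  have hham (u : M → ℝ) : hamiltonian (comp I J Λ) u x = J x (hamiltonian Λ u x) := rfl
  have hconc := hC _ _ hf.smoothForm hg.smoothForm x
  have hpair : pair I Λ (mvfderiv I f) (mvfderiv I g) x = diffBracket Λ f g x := rfl
  have hpair' : pair I (comp I J Λ) (mvfderiv I f) (mvfderiv I g) x =
    diffBracket (comp I J Λ) f g x := rfl
  have hham' (u : M → ℝ) : Λ x (mvfderiv I u x) = hamiltonian Λ u x := rfl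
  have htransp : Λ x (transp I J (mvfderiv I (diffBracket Λ f g)) x) =
    J x (hamiltonian Λ (diffBracket Λ f g) x) := (hc x _).symm
  rw [concomitant_mvfderiv hΛ hJ.smooth hc hf hg, hpair, hpair'] at hconc
  rw [lieEndo, lieEndo, sub_eq_iff_eq_add,
    mlieBracket_swap_apply (V := app I J (hamiltonian Λ f)) (W := hamiltonian Λ g),
    hS f g hf hg, hS.mlieBracket_app_hamiltonian hΛ hJ.smooth hc hf hg,
    hS.mlieBracket_app_hamiltonian hΛ hJ.smooth hc hg hf, hswap] at hnij
  refine hnij.trans ?_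
  simp only [hham, hham', htransp, app, map_add, map_sub, map_neg, map_smul] at hconc ⊢
  linear_combination (norm := module) - hconc

lemma IsBivector.comp_power (hΛ : IsBivector I Λ) (hJ : SmoothEndo I J) (hc : Commutes I J Λ)
    (k : ℕ) : IsBivector I (comp I (power I J k) Λ) :=
  hΛ.comp_endo (hJ.power k) (hc.power k)

lemma ConcomitantIdentity.comp_power (hC : ConcomitantIdentity Λ V J) (hΛ : IsBivector I Λ)
    (hJ : IsNijenhuis I J) (hc : Commutes I J Λ) (k : ℕ) :
    ConcomitantIdentity (comp I (power I J k) Λ) (app I (power I J k) V) J := by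
  induction k with
  | zero => rwa [comp_power_zero, app_power_zero]
  | succ k ih =>
    rw [comp_power_succ, app_power_succ]
    exact ih.comp_endo (hΛ.comp_power hJ.smooth hc k) hJ (hc.comp_power k)

lemma SchoutenIdentity.comp_power (hS : SchoutenIdentity Λ V) (hC : ConcomitantIdentity Λ V J)
    (hΛ : IsBivector I Λ) (hJ : IsNijenhuis I J) (hc : Commutes I J Λ) (k : ℕ) :
    SchoutenIdentity (comp I (power I J k) Λ) (app I (power I J k) V) := by
  induction k with
  | zero => rwa [comp_power_zero, app_power_zero]
  | succ k ih =>
    rw [comp_power_succ, app_power_succ]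
    exact ih.comp_endo (hC.comp_power hΛ hJ hc k) (hΛ.comp_power hJ.smooth hc k) hJ
      (hc.comp_power k)

lemma IsCompatible.concomitantIdentity (hK : IsCompatible I Λ V J) :
    ConcomitantIdentity Λ V J := by
  intro α β hα hβ x
  refine tangentVector_eq_of_forall_mvfderiv_eq fun f hf => ?_
  have h := hK.concomitant_eq α β _ hα hβ hf.smoothForm x
  have hpair : pair I Λ α (transp I J β) = pair I (comp I J Λ) α β := rfl
  simp only [transp, ContinuousLinearMap.comp_apply, map_add, map_sub, map_smul] at h ⊢
  rw [← hpair]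
  linear_combination h

lemma IsCompatible.preserves_power (hK : IsCompatible I Λ V J) (hΛV : IsJacobi I Λ V)
    (hJ : IsNijenhuis I J) (k : ℕ) :
    Preserves (app I (power I J k) V) (comp I (power I J k) Λ) := by
  obtain ⟨hΛ, hV, -, hpres⟩ := isJacobi_iff.1 hΛV
  rcases k.eq_zero_or_pos with rfl | hk
  · rwa [comp_power_zero, app_power_zero]
  have : CompleteSpace E := FiniteDimensional.complete ℝ E
  have hΛk := hΛ.comp_power hJ.smooth hK.commutes k
  have hVk := (hJ.smooth.power k).smoothVec_app hV
  intro f hf x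
  have hlie : mlieBracket I (app I (power I J k) V) (hamiltonian Λ f) x +
      mlieBracket I V (hamiltonian (comp I (power I J k) Λ) f) x =
      hamiltonian Λ (lieFun (app I (power I J k) V) f) x +
        power I J k x (mlieBracket I V (hamiltonian Λ f) x) := by
    refine tangentVector_eq_of_forall_mvfderiv_eq fun g hg => ?_
    have h := hK.lie_eq k hk _ _ hf.smoothForm hg.smoothForm x
    rw [lieBiv_mvfderiv _ hVk hf hg, lieBiv_mvfderiv _ hV hf hg, lieDefect_eq hΛ hVk hf hg,
      lieDefect_eq hΛk hV hf hg] at h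
    rw [hpres f hf, map_add, map_add]
    exact sub_eq_zero.1 (Eq.trans (by ring_nf; rfl) h)
  have hnij := hJ.lieEndo_app_power hV (hΛ.smoothVec_hamiltonian hf) k k x
  rw [lieEndo, lieEndo, sub_eq_iff_eq_add, ← map_add] at hnij
  refine hnij.trans (congrArg (power I J k x) ?_)
  have hham : app I (power I J k) (hamiltonian Λ f) = hamiltonian (comp I (power I J k) Λ) f := rfl
  rw [hham]
  exact (sub_add_eq_add_sub _ _ _).trans (sub_eq_iff_eq_add.2 ((add_comm _ _).trans hlie))

theorem IsCompatible.isJacobi_power (hK : IsCompatible I Λ V J) (hΛV : IsJacobi I Λ V)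
    (hJ : IsNijenhuis I J) (k : ℕ) :
    IsJacobi I (comp I (power I J k) Λ) (app I (power I J k) V) := by
  obtain ⟨hΛ, hV, hS, -⟩ := isJacobi_iff.1 hΛV
  exact isJacobi_iff.2 ⟨hΛ.comp_power hJ.smooth hK.commutes k,
    (hJ.smooth.power k).smoothVec_app hV,
    hS.comp_power hK.concomitantIdentity hΛ hJ hK.commutes k, hK.preserves_power hΛV hJ k⟩

end Hierarchy

/-! ### Poisson–Nijenhuis structures -/

section Pencils

variable {E : Type*} [NormedAddCommGroup E] [NormedSpace ℝ E]
  {H : Type*} [TopologicalSpace H] {I : ModelWithCorners ℝ E H}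
  {M : Type*} [TopologicalSpace M] [ChartedSpace H M]
  {Λ : Biv I M} {X X' Y Z : Vec I M} {J K : Endo I M} {α β : Form I M}

lemma Commutes.sub_smul (hJ : Commutes I J Λ) (hK : Commutes I K Λ) (c : ℝ) :
    Commutes I (fun x => J x - c • K x) Λ := by
  intro x a
  have ha : a.comp (J x - c • K x) = a.comp (J x) - c • a.comp (K x) := by
    ext v
    exact (map_sub a _ _).trans (congrArg _ (map_smul a c _))
  rw [ha, map_sub, map_smul, ← hJ, ← hK]
  rfl

lemma transp_power_succ (J : Endo I M) (k : ℕ) (α : Form I M) :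
    transp I (power I J (k + 1)) α = transp I J (transp I (power I J k) α) := by
  rw [power_succ']
  rfl

variable [IsManifold I ∞ M]

lemma SmoothForm.sub_smul (hα : SmoothForm I α) (hβ : SmoothForm I β) (c : ℝ) :
    SmoothForm I (fun x => α x - c • β x) :=
  ContMDiff.sub_section hα (ContMDiff.const_smul_section hβ)

variable [CompleteSpace E]

lemma mlieBracket_sub_smul_right (Z : Vec I M) (hX : SmoothVec I X) (hY : SmoothVec I Y) (c : ℝ)
    (x : M) : mlieBracket I Z (fun y => X y - c • Y y) x =
      mlieBracket I Z X x - c • mlieBracket I Z Y x := by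
  have hX' := (hX x).mdifferentiableAt (by simp)
  have hY' := (hY x).mdifferentiableAt (by simp)
  have hfield : (fun y => X y - c • Y y) = X + -c • Y :=
    funext fun y => by simp [sub_eq_add_neg]
  have hcY := (ContMDiff.const_smul_section (a := -c) hY x).mdifferentiableAt (by simp)
  rw [hfield, mlieBracket_add_right hX' hcY, mlieBracket_const_smul_right hY']
  module

lemma lieEndo_sub_smul_left (hX : SmoothVec I X) (hX' : SmoothVec I X') (J : Endo I M) (c : ℝ)
    (Y : Vec I M) (x : M) : lieEndo (fun y => X y - c • X' y) J Y x =
      lieEndo X J Y x - c • lieEndo X' J Y x := by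
  have hbracket (W : Vec I M) : mlieBracket I (fun y => X y - c • X' y) W x =
      mlieBracket I X W x - c • mlieBracket I X' W x := by
    rw [mlieBracket_swap_apply, mlieBracket_sub_smul_right W hX hX',
      mlieBracket_swap_apply (V := W), mlieBracket_swap_apply (V := W)]
    module
  simp only [lieEndo, hbracket, map_sub, map_smul]
  module

lemma lieEndo_sub_smul_right (hJ : SmoothEndo I J) (hK : SmoothEndo I K) (hX : SmoothVec I X)
    (Y : Vec I M) (c : ℝ) (x : M) : lieEndo Y (fun y => J y - c • K y) X x =
      lieEndo Y J X x - c • lieEndo Y K X x := by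
  have happ : app I (fun y => J y - c • K y) X = fun y => app I J X y - c • app I K X y := rfl
  rw [lieEndo, happ, mlieBracket_sub_smul_right Y (hJ.smoothVec_app hX) (hK.smoothVec_app hX)]
  simp only [lieEndo, _root_.sub_apply, _root_.smul_apply]
  module

lemma IsNijenhuis.power_sub_smul (hJ : IsNijenhuis I J) (k l : ℕ) (c : ℝ) :
    IsNijenhuis I (fun x => power I J k x - c • power I J l x) where
  smooth := (hJ.smooth.power k).sub_smul (hJ.smooth.power l) c
  torsion_eq_zero X Y hX hY x := by
    have hk := hJ.smooth.power k
    have hl := hJ.smooth.power l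
    have happ : app I (fun y => power I J k y - c • power I J l y) X =
      fun y => app I (power I J k) X y - c • app I (power I J l) X y := rfl
    rw [torsion_eq, happ, lieEndo_sub_smul_left (hk.smoothVec_app hX) (hl.smoothVec_app hX)]
    simp only [lieEndo_sub_smul_right hk hl hY, hJ.lieEndo_app_power hX hY, _root_.sub_apply,
      _root_.smul_apply, map_sub, map_smul]
    module

end Pencils

section PoissonNijenhuis

variable {E : Type*} [NormedAddCommGroup E] [NormedSpace ℝ E] [FiniteDimensional ℝ E]
  {H : Type*} [TopologicalSpace H] {I : ModelWithCorners ℝ E H}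
  {M : Type*} [TopologicalSpace M] [ChartedSpace H M] [IsManifold I ∞ M]
  {Λ P : Biv I M} {X V Z : Vec I M} {J K : Endo I M} {α β : Form I M}

lemma concomitant_sub_smul_apply (hΛ : IsBivector I Λ) (hJ : SmoothEndo I J) (hK : SmoothEndo I K)
    (hcJ : Commutes I J Λ) (hcK : Commutes I K Λ) (c : ℝ) (hα : SmoothForm I α)
    (hβ : SmoothForm I β) (hX : SmoothVec I X) (x : M) :
    concomitant I Λ (fun y => J y - c • K y) α β x (X x) =
      concomitant I Λ J α β x (X x) - c * concomitant I Λ K α β x (X x) := by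
  have hpairJ : SmoothFun I (pair I (comp I J Λ) α β) :=
    hβ.smoothFun_apply (hJ.smoothVec_app (hΛ.smoothVec_sharp hα))
  have hpairK : SmoothFun I (pair I (comp I K Λ) α β) :=
    hβ.smoothFun_apply (hK.smoothVec_app (hΛ.smoothVec_sharp hα))
  have hpair : pair I (comp I (fun y => J y - c • K y) Λ) α β =
      fun y => pair I (comp I J Λ) α β y - c * pair I (comp I K Λ) α β y :=
    funext fun y => (map_sub (β y) _ _).trans (congrArg _ (map_smul (β y) c _))
  have happ (f : M → ℝ) : lieFun (app I (fun y => J y - c • K y) X) f x =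
      lieFun (app I J X) f x - c * lieFun (app I K X) f x :=
    (map_sub (mvfderiv I f x) _ _).trans (congrArg _ (map_smul (mvfderiv I f x) c _))
  have := FiniteDimensional.complete ℝ E
  rw [concomitant_apply (hcJ.sub_smul hcK c) (hJ.sub_smul hK c) hα hβ hX,
    concomitant_apply hcJ hJ hα hβ hX, concomitant_apply hcK hK hα hβ hX, hpair,
    lieFun_sub hpairJ ((smoothFun_const c).mul hpairK), lieFun_mul (smoothFun_const c) hpairK,
    lieFun_const, happ, lieEndo_sub_smul_right hJ hK hX, lieEndo_sub_smul_right hJ hK hX]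
  simp only [map_sub, map_smul, smul_eq_mul, mul_zero, add_zero]
  ring

lemma lieForm_sub_smul [T2Space M] (X : Vec I M) (hα : SmoothForm I α) (hβ : SmoothForm I β) (c : ℝ)
    (x : M) :
    lieForm I X (fun y => α y - c • β y) x = lieForm I X α x - c • lieForm I X β x := by
  refine covector_eq_of_forall_smoothVec fun Y hY => ?_
  have hαY := hα.smoothFun_apply hY
  have hβY := hβ.smoothFun_apply hY
  have hlie : lieFun X (fun y => (α y - c • β y) (Y y)) x =
      lieFun X (fun y => α y (Y y)) x - c * lieFun X (fun y => β y (Y y)) x := by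
    have happ : (fun y => (α y - c • β y) (Y y)) = fun y => α y (Y y) - c * β y (Y y) := rfl
    rw [happ, lieFun_sub hαY ((smoothFun_const c).mul hβY), lieFun_mul (smoothFun_const c) hβY,
      lieFun_const, mul_zero, add_zero]
  rw [lieForm_apply I (hα.sub_smul hβ c) hY]
  refine (congrArg₂ _ hlie rfl).trans ?_
  refine Eq.trans ?_
    (congrArg₂ (fun a b => a - c * b) (lieForm_apply I hα hY x) (lieForm_apply I hβ hY x)).symm
  simp only [lieFun, _root_.sub_apply, _root_.smul_apply, smul_eq_mul]
  ring

lemma concomitant_id (Λ : Biv I M) (α β : Form I M) (x : M) :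
    concomitant I Λ (fun x => ContinuousLinearMap.id ℝ (TangentSpace I x)) α β x = 0 := by
  have hexpand : concomitant I Λ (fun x => ContinuousLinearMap.id ℝ (TangentSpace I x)) α β x =
      formBracket I Λ α β x
        - (formBracket I Λ α β x + formBracket I Λ α β x - formBracket I Λ α β x) := rfl
  rw [hexpand, add_sub_cancel_right, sub_self]

/- If `Λ = 0` and `V ≠ 0`, every tensor that commutes with the Poissonization `e⁻ᵗ ∂ₜ ∧ V` is a
multiple of the identity on the span of `∂ₜ` and `V`, so the identity is the only natural choice. -/
lemma IsPoisson.isPoissonNijenhuis_id (hP : IsPoisson I P) :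
    IsPoissonNijenhuis I P (fun x : M => ContinuousLinearMap.id ℝ (TangentSpace I x)) where
  isPoisson := hP
  isNijenhuis := isNijenhuis_id
  commutes _ _ := rfl
  concomitant_eq_zero α β _ _ x := concomitant_id P α β x

variable [T2Space M]

lemma isPoisson_iff : IsPoisson I P ↔ IsBivector I P ∧ SchoutenIdentity P (fun _ => 0) := by
  have hzero (f : M → ℝ) : lieFun (fun x => (0 : TangentSpace I x)) f = fun _ => 0 :=
    funext fun x => map_zero (mvfderiv I f x)
  have hpres : Preserves (fun x => (0 : TangentSpace I x)) P := by
    intro f _ x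
    have hconst : mvfderiv I (fun _ : M => (0 : ℝ)) x = 0 := mvfderiv_const 0
    simp only [hzero, hamiltonian]
    exact (congrFun mlieBracket_zero_left x).trans ((congrArg _ hconst).trans (map_zero _)).symm
  have hsmooth : SmoothVec I (fun x : M => (0 : TangentSpace I x)) :=
    Bundle.contMDiff_zeroSection ℝ _
  rw [IsPoisson, isJacobi_iff]
  exact ⟨fun h => ⟨h.1, h.2.2.1⟩, fun h => ⟨h.1, hsmooth, h.2, hpres⟩⟩

theorem IsPoissonNijenhuis.isPoisson_comp (hP : IsPoissonNijenhuis I P J) :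
    IsPoisson I (comp I J P) := by
  obtain ⟨hbiv, hS⟩ := isPoisson_iff.1 hP.isPoisson
  have hC : ConcomitantIdentity P (fun _ => 0) J := by
    intro α β hα hβ x
    simp only [hP.concomitant_eq_zero α β hα hβ, map_zero, smul_zero, sub_zero]
  have happ : app I J (fun _ => 0) = fun _ => 0 := funext fun x => map_zero (J x)
  refine isPoisson_iff.2 ⟨hbiv.comp_endo hP.isNijenhuis.smooth hP.commutes, ?_⟩
  simpa only [happ] using hS.comp_endo hC hbiv hP.isNijenhuis hP.commutes

lemma IsPoissonNijenhuis.concomitant_power_eq_zero (hP : IsPoissonNijenhuis I P J)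
    (hα : SmoothForm I α) (hβ : SmoothForm I β) (k : ℕ) (x : M) :
    concomitant I P (power I J k) α β x = 0 := by
  induction k generalizing β with
  | zero => rw [power_zero, concomitant_id]
  | succ k ih =>
    refine covector_eq_of_forall_smoothVec fun X hX => ?_
    rw [hP.isNijenhuis.concomitant_power_succ_apply hP.commutes hP.isPoisson.isBivector hα hβ hX,
      hP.concomitant_eq_zero α β hα hβ, ih (hP.isNijenhuis.smooth.smoothForm_transp hβ)]
    exact add_zero (0 : ℝ)

theorem IsPoissonNijenhuis.power_sub_smul (hP : IsPoissonNijenhuis I P J) (k l : ℕ) (c : ℝ) :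
    IsPoissonNijenhuis I P (fun x => power I J k x - c • power I J l x) where
  isPoisson := hP.isPoisson
  isNijenhuis :=
    have := FiniteDimensional.complete ℝ E
    hP.isNijenhuis.power_sub_smul k l c
  commutes := (hP.commutes.power k).sub_smul (hP.commutes.power l) c
  concomitant_eq_zero α β hα hβ x := by
    have hJ := hP.isNijenhuis.smooth
    refine covector_eq_of_forall_smoothVec fun X hX => ?_
    rw [concomitant_sub_smul_apply hP.isPoisson.isBivector (hJ.power k) (hJ.power l)
      (hP.commutes.power k) (hP.commutes.power l) c hα hβ hX,
      hP.concomitant_power_eq_zero hα hβ, hP.concomitant_power_eq_zero hα hβ]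
    exact (congrArg _ (mul_zero c)).trans (sub_zero (0 : ℝ))

end PoissonNijenhuis

section Homogeneity

variable {E : Type*} [NormedAddCommGroup E] [NormedSpace ℝ E] [FiniteDimensional ℝ E]
  {H : Type*} [TopologicalSpace H] {I : ModelWithCorners ℝ E H}
  {M : Type*} [TopologicalSpace M] [ChartedSpace H M] [IsManifold I ∞ M]
  {P : Biv I M} {Z : Vec I M} {J : Endo I M} {α β : Form I M}

/-- The homogeneity `[Z, Λ] = -Λ`, tested on differentials of functions. -/
def IsHomogeneousBiv (Λ : Biv I M) (Z : Vec I M) : Prop :=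
  ∀ f g : M → ℝ, SmoothFun I f → SmoothFun I g → ∀ x,
    lieDefect Λ Z f g x = - diffBracket Λ f g x

lemma IsHomogeneousPoissonNijenhuis.lieForm_transp (hP : IsHomogeneousPoissonNijenhuis I P J Z)
    (hα : SmoothForm I α) (x : M) :
    P x (lieForm I Z (transp I J α) x) = P x (transp I J (lieForm I Z α) x) :=
  sub_eq_zero.1 ((map_sub (P x) _ _).symm.trans (hP.comp_eq_zero α hα x))

lemma IsHomogeneousPoissonNijenhuis.lieForm_transp_power
    (hP : IsHomogeneousPoissonNijenhuis I P J Z) (hα : SmoothForm I α) (k : ℕ) (x : M) :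
    P x (lieForm I Z (transp I (power I J k) α) x) =
      P x (transp I (power I J k) (lieForm I Z α) x) := by
  have hc := hP.isPoissonNijenhuis.commutes
  have hJ := hP.isPoissonNijenhuis.isNijenhuis.smooth
  induction k with
  | zero => rw [power_zero]; rfl
  | succ k ih =>
    have hα' := (hJ.power k).smoothForm_transp hα
    rw [transp_power_succ, hP.lieForm_transp hα', transp_power_succ]
    exact (hc x _).symm.trans ((congrArg (J x) ih).trans (hc x _))

variable [T2Space M]

lemma IsHomogeneousPoissonNijenhuis.isHomogeneousBiv_comp
    (hP : IsHomogeneousPoissonNijenhuis I P J Z) : IsHomogeneousBiv (comp I J P) Z := by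
  intro f g hf hg x
  have hc := hP.isPoissonNijenhuis.commutes
  have hJf := hP.isPoissonNijenhuis.isNijenhuis.smooth.smoothForm_transp hf.smoothForm
  have hpair : pair I P (lieForm I Z (transp I J (mvfderiv I f))) (mvfderiv I g) x =
      pair I (comp I J P) (lieForm I Z (mvfderiv I f)) (mvfderiv I g) x :=
    (congrArg (mvfderiv I g x) (hP.lieForm_transp hf.smoothForm x)).trans
      (congrFun (hc.pair_transp_left _ _) x)
  have h := hP.homogeneous _ _ hJf hg.smoothForm x
  rw [lieBiv, hpair, hc.pair_transp_left, hc.pair_transp_left] at h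
  exact (lieBiv_mvfderiv _ hP.smoothVec hf hg x).symm.trans h

theorem IsHomogeneousPoissonNijenhuis.power_sub_smul
    (hP : IsHomogeneousPoissonNijenhuis I P J Z) (k l : ℕ) (c : ℝ) :
    IsHomogeneousPoissonNijenhuis I P (fun x => power I J k x - c • power I J l x) Z where
  isPoissonNijenhuis := hP.isPoissonNijenhuis.power_sub_smul k l c
  smoothVec := hP.smoothVec
  homogeneous := hP.homogeneous
  comp_eq_zero α hα x := by
    have hJ := hP.isPoissonNijenhuis.isNijenhuis.smooth
    have htransp (γ : Form I M) : transp I (fun x => power I J k x - c • power I J l x) γ =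
        fun x => transp I (power I J k) γ x - c • transp I (power I J l) γ x := by
      funext x
      ext v
      exact (map_sub (γ x) _ _).trans (congrArg _ (map_smul (γ x) c _))
    rw [htransp, htransp, lieForm_sub_smul Z ((hJ.power k).smoothForm_transp hα)
      ((hJ.power l).smoothForm_transp hα)]
    simp only [map_sub, map_smul, hP.lieForm_transp_power hα, sub_self]

lemma IsHomogeneousPoissonNijenhuis.power (hP : IsHomogeneousPoissonNijenhuis I P J Z) (k : ℕ) :
    IsHomogeneousPoissonNijenhuis I P (JacobiNijenhuis.power I J k) Z := by
  simpa only [zero_smul, sub_zero] using hP.power_sub_smul k 0 0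

end Homogeneity

/-! ### Poissonization -/

section Poissonization

section LinearAlgebra

variable {E : Type*} [NormedAddCommGroup E] [NormedSpace ℝ E]

/-- The linear map of the bivector `c (L + ∂ₜ ∧ v)` on `E × ℝ`. -/
noncomputable def poissonMap (L : (E →L[ℝ] ℝ) →L[ℝ] E) (v : E) (c : ℝ) :
    ((E × ℝ) →L[ℝ] ℝ) →L[ℝ] E × ℝ :=
  c • ((L.comp ((ContinuousLinearMap.compL ℝ E (E × ℝ) ℝ).flip
      (ContinuousLinearMap.inl ℝ E ℝ))
    + (ContinuousLinearMap.apply ℝ ℝ ((0, 1) : E × ℝ)).smulRight v).prod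
      (-(ContinuousLinearMap.apply ℝ ℝ ((v, 0) : E × ℝ))))

lemma poissonMap_apply (L : (E →L[ℝ] ℝ) →L[ℝ] E) (v : E) (c : ℝ) (a : (E × ℝ) →L[ℝ] ℝ) :
    poissonMap L v c a =
      (c • (L (a.comp (ContinuousLinearMap.inl ℝ E ℝ)) + a (0, 1) • v), c * - a (v, 0)) := rfl

lemma apply_poissonMap (L : (E →L[ℝ] ℝ) →L[ℝ] E) (v : E) (c : ℝ) {a b : E × ℝ →L[ℝ] ℝ}
    {α β : E →L[ℝ] ℝ} {r s : ℝ} (ha : ∀ u t, a (u, t) = α u + r * t)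
    (hb : ∀ u t, b (u, t) = β u + s * t) :
    b (poissonMap L v c a) = c * (β (L α) + r * β v - s * α v) := by
  have hα : a.comp (ContinuousLinearMap.inl ℝ E ℝ) = α := by
    ext u
    exact (ha u 0).trans (by rw [mul_zero, add_zero])
  rw [poissonMap_apply, hα, hb, ha, ha]
  simp only [map_smul, map_add, smul_eq_mul, map_zero]
  ring

lemma apply_poissonMap_mul (L : (E →L[ℝ] ℝ) →L[ℝ] E) (v : E) {c e : ℝ} (hce : c * e = 1)
    {a b : E × ℝ →L[ℝ] ℝ} {α β : E →L[ℝ] ℝ} {r s : ℝ} (ha : ∀ u t, a (u, t) = e * (α u + r * t))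
    (hb : ∀ u t, b (u, t) = e * (β u + s * t)) :
    b (poissonMap L v c a) = e * (β (L α) + (r * β v - s * α v)) := by
  have ha' (u : E) (t : ℝ) : a (u, t) = (e • α) u + e * r * t := by
    rw [ha, mul_add, mul_assoc]
    rfl
  have hb' (u : E) (t : ℝ) : b (u, t) = (e • β) u + e * s * t := by
    rw [hb, mul_add, mul_assoc]
    rfl
  rw [apply_poissonMap L v c ha' hb']
  simp only [_root_.smul_apply, map_smul, smul_eq_mul]
  linear_combination e * (β (L α) + r * β v - s * α v) * hce

lemma clm_prod_apply (a : E × ℝ →L[ℝ] ℝ) (u : E) (t : ℝ) :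
    a (u, t) = a.comp (ContinuousLinearMap.inl ℝ E ℝ) u + a (0, 1) * t := by
  have hsplit : (u, t) = (u, 0) + t • ((0, 1) : E × ℝ) := by simp
  rw [hsplit, map_add, map_smul, smul_eq_mul, mul_comm]
  rfl

lemma poissonMap_skew {L : (E →L[ℝ] ℝ) →L[ℝ] E} (hL : ∀ a b : E →L[ℝ] ℝ, b (L a) = - a (L b))
    (v : E) (c : ℝ) (a b : E × ℝ →L[ℝ] ℝ) :
    b (poissonMap L v c a) = - a (poissonMap L v c b) := by
  rw [apply_poissonMap L v c (clm_prod_apply a) (clm_prod_apply b),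
    apply_poissonMap L v c (clm_prod_apply b) (clm_prod_apply a), hL]
  ring

end LinearAlgebra

variable {E : Type*} [NormedAddCommGroup E] [NormedSpace ℝ E]
  {H : Type*} [TopologicalSpace H] {I : ModelWithCorners ℝ E H}
  {M : Type*} [TopologicalSpace M] [ChartedSpace H M]
  {Λ : Biv I M} {V : Vec I M} {f g : M → ℝ} {φ : ℝ → ℝ}

/-- The Poissonization `e⁻ᵗ (Λ + ∂ₜ ∧ V)` of `(Λ, V)`. -/
noncomputable def poissonization (Λ : Biv I M) (V : Vec I M) : Biv (I.prod 𝓘(ℝ, ℝ)) (M × ℝ) :=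
  fun p => poissonMap (E := E) (Λ p.1) (V p.1) (Real.exp (-p.2))

lemma SmoothFun.comp_fst (hf : SmoothFun I f) :
    SmoothFun (I.prod 𝓘(ℝ, ℝ)) (fun p : M × ℝ => f p.1) :=
  ContMDiff.comp hf contMDiff_fst

lemma smoothFun_comp_snd (hφ : ContDiff ℝ ∞ φ) :
    SmoothFun (I.prod 𝓘(ℝ, ℝ)) (fun p : M × ℝ => φ p.2) :=
  ContMDiff.comp hφ.contMDiff contMDiff_snd

lemma mvfderiv_comp_fst (hf : SmoothFun I f) (p : M × ℝ) :
    mvfderiv (I.prod 𝓘(ℝ, ℝ)) (fun p : M × ℝ => f p.1) p =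
      (mvfderiv I f p.1).comp (ContinuousLinearMap.fst ℝ E ℝ) := by
  have hchain := mfderiv_comp p (hf.mdifferentiableAt p.1) (mdifferentiableAt_fst (I := I)
    (I' := 𝓘(ℝ, ℝ)) (x := p))
  rw [mfderiv_fst] at hchain
  ext v
  exact congrArg (fun L : E × ℝ →L[ℝ] ℝ => L v) hchain

lemma mvfderiv_comp_snd (hφ : ContDiff ℝ ∞ φ) (p : M × ℝ) :
    mvfderiv (I.prod 𝓘(ℝ, ℝ)) (fun p : M × ℝ => φ p.2) p =
      (deriv φ p.2) • (ContinuousLinearMap.snd ℝ E ℝ) := by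
  have hdiff := (hφ.differentiable (by simp) p.2).mdifferentiableAt
  have hchain := mfderiv_comp p hdiff (mdifferentiableAt_snd (I := I) (I' := 𝓘(ℝ, ℝ)) (x := p))
  rw [mfderiv_snd, mfderiv_eq_fderiv] at hchain
  ext v
  refine (congrArg (fun L : E × ℝ →L[ℝ] ℝ => L v) hchain).trans ?_
  exact (fderiv_eq_smul_deriv v.2).trans (mul_comm _ _)

lemma smoothFun_exp_mul (hf : SmoothFun I f) :
    SmoothFun (I.prod 𝓘(ℝ, ℝ)) (fun p : M × ℝ => Real.exp p.2 * f p.1) :=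
  (smoothFun_comp_snd Real.contDiff_exp).mul hf.comp_fst

lemma mvfderiv_exp_mul (hf : SmoothFun I f) (p : M × ℝ) (u : E) (t : ℝ) :
    mvfderiv (I.prod 𝓘(ℝ, ℝ)) (fun p : M × ℝ => Real.exp p.2 * f p.1) p (u, t) =
      Real.exp p.2 * (mvfderiv I f p.1 u + f p.1 * t) := by
  rw [mvfderiv_fun_mul (smoothFun_comp_snd Real.contDiff_exp) hf.comp_fst,
    mvfderiv_comp_fst hf, mvfderiv_comp_snd Real.contDiff_exp, Real.deriv_exp]
  have happly : (Real.exp p.2 • (mvfderiv I f p.1).comp (ContinuousLinearMap.fst ℝ E ℝ)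
      + f p.1 • Real.exp p.2 • ContinuousLinearMap.snd ℝ E ℝ) (u, t) =
      Real.exp p.2 * mvfderiv I f p.1 u + f p.1 * (Real.exp p.2 * t) := rfl
  refine happly.trans ?_
  ring

lemma diffBracket_poissonization (hf : SmoothFun I f) (hg : SmoothFun I g) :
    diffBracket (poissonization Λ V) (fun p : M × ℝ => Real.exp p.2 * f p.1)
      (fun p : M × ℝ => Real.exp p.2 * g p.1) = fun p => Real.exp p.2 * bracket I Λ V f g p.1 := by
  have hexp (t : ℝ) : Real.exp (-t) * Real.exp t = 1 := by rw [← Real.exp_add]; simp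
  exact funext fun p => apply_poissonMap_mul (E := E) (Λ p.1) (V p.1) (hexp p.2)
    (mvfderiv_exp_mul hf p) (mvfderiv_exp_mul hg p)

lemma exists_mvfderiv_clm_comp_extChartAt_prod [FiniteDimensional ℝ E] [IsManifold I ∞ M]
    [T2Space M] (α : E × ℝ →L[ℝ] ℝ) (p : M × ℝ) :
    ∃ (f : M → ℝ) (c : ℝ), SmoothFun I f ∧ ∀ᶠ q in 𝓝 p, ∀ (u : E) (t : ℝ),
      mvfderiv (I.prod 𝓘(ℝ, ℝ)) (α ∘ extChartAt (I.prod 𝓘(ℝ, ℝ)) p) q (u, t) =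
        mvfderiv I f q.1 u + c * t := by
  obtain ⟨f, hf, hfα⟩ := exists_smoothFun_eventuallyEq
    (eventually_contMDiffAt_clm_comp_extChartAt (I := I)
      (α.comp (ContinuousLinearMap.inl ℝ E ℝ)) p.1)
  refine ⟨f, α (0, 1), hf, ?_⟩
  have hφ : ContDiff ℝ ∞ (fun t : ℝ => α (0, 1) * t) := contDiff_const.mul contDiff_id
  have hsplit : α ∘ extChartAt (I.prod 𝓘(ℝ, ℝ)) p =ᶠ[𝓝 p] fun q => f q.1 + α (0, 1) * q.2 := by
    filter_upwards [continuousAt_fst.eventually hfα] with q hq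
    have hchart : extChartAt (I.prod 𝓘(ℝ, ℝ)) p q = (extChartAt I p.1 q.1, q.2) := by
      rw [extChartAt_prod]
      rfl
    rw [hq, Function.comp_apply, hchart, clm_prod_apply]
    rfl
  filter_upwards [hsplit.eventuallyEq_nhds] with q hq u t
  have hadd := mvfderiv_add (hf.comp_fst.mdifferentiableAt q)
    ((smoothFun_comp_snd (I := I) hφ).mdifferentiableAt q)
  rw [mvfderiv_congr hq]
  refine (congrArg (fun L : E × ℝ →L[ℝ] ℝ => L (u, t)) hadd).trans ?_
  rw [mvfderiv_comp_fst hf, mvfderiv_comp_snd hφ, deriv_const_mul_id]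
  rfl

variable [FiniteDimensional ℝ E] [IsManifold I ∞ M] [T2Space M]

lemma isBivector_poissonization (hΛ : IsBivector I Λ) (hV : SmoothVec I V) :
    IsBivector (I.prod 𝓘(ℝ, ℝ)) (poissonization Λ V) := by
  refine isBivector_of_coordinates
    (fun p a b => poissonMap_skew (E := E) (hΛ.skew p.1) (V p.1) _ a b) fun p α β => ?_
  obtain ⟨f, c, hf, hfα⟩ := exists_mvfderiv_clm_comp_extChartAt_prod (I := I) α p
  obtain ⟨g, d, hg, hgβ⟩ := exists_mvfderiv_clm_comp_extChartAt_prod (I := I) β p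
  have hexp : ContDiff ℝ ∞ (fun t : ℝ => Real.exp (-t)) := by fun_prop
  have hpair := ((hΛ.smoothFun_diffBracket hf hg).add
    ((smoothFun_const c).mul (hg.lieFun hV))).sub ((smoothFun_const d).mul (hf.lieFun hV))
  refine ((smoothFun_comp_snd hexp).mul hpair.comp_fst p).congr_of_eventuallyEq ?_
  filter_upwards [hfα, hgβ] with q hα hβ
  exact apply_poissonMap (E := E) (Λ q.1) (V q.1) (Real.exp (-q.2)) hα hβ

lemma exists_mvfderiv_exp_mul_eq {p : M × ℝ}
    (a : TangentSpace (I.prod 𝓘(ℝ, ℝ)) p →L[ℝ] ℝ) :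
    ∃ f : M → ℝ, SmoothFun I f ∧
      mvfderiv (I.prod 𝓘(ℝ, ℝ)) (fun q : M × ℝ => Real.exp q.2 * f q.1) p = a := by
  let A : E × ℝ →L[ℝ] ℝ := a
  obtain ⟨f, hf, hfA⟩ := exists_smoothFun_mvfderiv_eq (I := I) (x := p.1)
    (Real.exp (- p.2) • A.comp (ContinuousLinearMap.inl ℝ E ℝ))
  have hf' := hf.add (smoothFun_const (I := I) (Real.exp (- p.2) * A (0, 1) - f p.1))
  have hdf : mvfderiv I (fun x => f x + (Real.exp (-p.2) * A (0, 1) - f p.1)) p.1 =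
      Real.exp (-p.2) • A.comp (ContinuousLinearMap.inl ℝ E ℝ) := by
    refine (mvfderiv_add (hf.mdifferentiableAt p.1)
      ((smoothFun_const _).mdifferentiableAt p.1)).trans ?_
    rw [mvfderiv_const, add_zero, hfA]
  refine ⟨_, hf', ?_⟩
  have hexp : Real.exp p.2 * Real.exp (-p.2) = 1 := by rw [← Real.exp_add]; simp
  ext ⟨u, t⟩
  refine (mvfderiv_exp_mul hf' p u t).trans (.trans ?_ (clm_prod_apply A u t).symm)
  rw [hdf, add_sub_cancel]
  refine Eq.trans (b := Real.exp p.2 * (Real.exp (-p.2) * A.comp (.inl ℝ E ℝ) u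
    + Real.exp (-p.2) * A (0, 1) * t)) rfl ?_
  linear_combination (A.comp (.inl ℝ E ℝ) u + A (0, 1) * t) * hexp

theorem IsJacobi.isPoisson_poissonization (hΛV : IsJacobi I Λ V) :
    IsPoisson (I.prod 𝓘(ℝ, ℝ)) (poissonization Λ V) := by
  have hP := isBivector_poissonization hΛV.isBivector hΛV.smoothVec
  have hb {f g : M → ℝ} (hf : SmoothFun I f) (hg : SmoothFun I g) :=
    hΛV.isBivector.smoothFun_bracket hΛV.smoothVec hf hg
  refine isPoisson_iff.2 ⟨hP, (schoutenIdentity_iff hP).2 fun F G K hF hG hK p => ?_⟩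
  obtain ⟨f, hf, hfF⟩ := exists_mvfderiv_exp_mul_eq (mvfderiv (I.prod 𝓘(ℝ, ℝ)) F p)
  obtain ⟨g, hg, hgG⟩ := exists_mvfderiv_exp_mul_eq (mvfderiv (I.prod 𝓘(ℝ, ℝ)) G p)
  obtain ⟨k, hk, hkK⟩ := exists_mvfderiv_exp_mul_eq (mvfderiv (I.prod 𝓘(ℝ, ℝ)) K p)
  have := FiniteDimensional.complete ℝ E
  rw [schoutenDefect_congr hP hF hG hK (smoothFun_exp_mul hf) (smoothFun_exp_mul hg)
    (smoothFun_exp_mul hk) hfF.symm hgG.symm hkK.symm]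
  simp only [schoutenDefect, lieFun, map_zero, zero_mul, add_zero]
  rw [diffBracket_poissonization hg hk, diffBracket_poissonization hk hf,
    diffBracket_poissonization hf hg, diffBracket_poissonization hf (hb hg hk),
    diffBracket_poissonization hg (hb hk hf), diffBracket_poissonization hk (hb hf hg),
    ← mul_add, ← mul_add, hΛV.jacobi f g k hf hg hk, mul_zero]

theorem IsJacobi.isConformalJacobiMorphism_fst (hΛV : IsJacobi I Λ V) :
    IsConformalJacobiMorphism (I.prod 𝓘(ℝ, ℝ)) I (poissonization Λ V) (fun _ => 0) Λ V
      (Prod.fst : M × ℝ → M) where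
  source := hΛV.isPoisson_poissonization
  target := hΛV
  smooth := contMDiff_fst
  conformal := by
    refine ⟨fun p => Real.exp p.2, smoothFun_comp_snd Real.contDiff_exp,
      fun p => Real.exp_ne_zero _, fun f g hf hg p => ?_⟩
    rw [bracket_apply, diffBracket_poissonization hf hg]
    simp only [lieFun, map_zero, mul_zero, sub_zero, add_zero]

end Poissonization

/-! ### Transverse hypersurfaces -/

section Complements

variable {E : Type*} [NormedAddCommGroup E] [NormedSpace ℝ E]
  {E' : Type*} [NormedAddCommGroup E'] [NormedSpace ℝ E'] {d : E' →L[ℝ] E} {z : E}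

lemma bivector_decomposition_eq {p : E →L[ℝ] E'} {η : E →L[ℝ] ℝ} (hpd : ∀ v, p (d v) = v)
    (hpz : p z = 0) (hηd : ∀ v, η (d v) = 0) (hηz : η z = 1) {P : (E →L[ℝ] ℝ) →L[ℝ] E}
    {L : (E' →L[ℝ] ℝ) →L[ℝ] E'} {v : E'}
    (h : ∀ a b : E →L[ℝ] ℝ,
      b (P a) = (b.comp d) (L (a.comp d)) + (a z * b (d v) - b z * a (d v))) :
    (∀ a, L a = p (P (a.comp p))) ∧ v = p (P η) := by
  have hcomp (a : E' →L[ℝ] ℝ) : (a.comp p).comp d = a :=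
    ContinuousLinearMap.ext fun w => congrArg a (hpd w)
  have hηcomp : η.comp d = 0 := ContinuousLinearMap.ext hηd
  refine ⟨fun a => ?_, ?_⟩ <;>
    refine (SeparatingDual.eq_iff_forall_dual_eq (R := ℝ)).2 fun b => ?_
  · have hab := h (a.comp p) (b.comp p)
    simpa only [hcomp, ContinuousLinearMap.comp_apply, hpz, map_zero, zero_mul, sub_zero,
      add_zero] using hab.symm
  · have hb := h η (b.comp p)
    simpa only [hηcomp, ContinuousLinearMap.comp_apply, hpd, hpz, hηd, hηz, map_zero, zero_mul,
      mul_zero, one_mul, sub_zero, zero_add] using hb.symm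

variable [FiniteDimensional ℝ E] [FiniteDimensional ℝ E']

lemma exists_prod_equiv (hd : Function.Injective d) (hz : z ∉ range d)
    (hdim : Module.finrank ℝ E = Module.finrank ℝ E' + 1) :
    ∃ e : (E' × ℝ) ≃L[ℝ] E, ∀ v t, e (v, t) = d v + t • z := by
  let L : E' × ℝ →ₗ[ℝ] E := d.toLinearMap.coprod (LinearMap.toSpanSingleton ℝ E z)
  have hL : ∀ v t, L (v, t) = d v + t • z := fun v t => rfl
  have hinj : Function.Injective L := by
    refine (injective_iff_map_eq_zero L).2 fun ⟨v, t⟩ hvt => ?_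
    have hsum : d v + t • z = 0 := (hL v t).symm.trans hvt
    have ht : t = 0 := by
      by_contra ht
      refine hz ⟨-(t⁻¹ • v), ?_⟩
      rw [map_neg, map_smul, eq_neg_of_add_eq_zero_left hsum, smul_neg, neg_neg,
        inv_smul_smul₀ ht]
    rw [ht, zero_smul, add_zero] at hsum
    rw [ht, hd (hsum.trans (map_zero d).symm), Prod.mk_zero_zero]
  have hfinrank : Module.finrank ℝ (E' × ℝ) = Module.finrank ℝ E := by
    rw [hdim, Module.finrank_prod, Module.finrank_self]
  exact ⟨(LinearEquiv.ofInjectiveOfFinrankEq L hinj hfinrank).toContinuousLinearEquiv, hL⟩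

lemma exists_projections (hd : Function.Injective d) (hz : z ∉ range d)
    (hdim : Module.finrank ℝ E = Module.finrank ℝ E' + 1) :
    ∃ (p : E →L[ℝ] E') (η : E →L[ℝ] ℝ), (∀ v, p (d v) = v) ∧ p z = 0 ∧ (∀ v, η (d v) = 0) ∧
      η z = 1 ∧ ∀ u, d (p u) + η u • z = u := by
  obtain ⟨e, he⟩ := exists_prod_equiv hd hz hdim
  have hed (v : E') : e.symm (d v) = (v, 0) := by
    rw [e.symm_apply_eq, he, zero_smul, add_zero]
  have hez : e.symm z = (0, 1) := by
    rw [e.symm_apply_eq, he, map_zero, one_smul, zero_add]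
  refine ⟨(ContinuousLinearMap.fst ℝ E' ℝ).comp e.symm.toContinuousLinearMap,
    (ContinuousLinearMap.snd ℝ E' ℝ).comp e.symm.toContinuousLinearMap,
    fun v => congrArg Prod.fst (hed v), congrArg Prod.fst hez,
    fun v => congrArg Prod.snd (hed v), congrArg Prod.snd hez, fun u => ?_⟩
  exact (he _ _).symm.trans (e.apply_symm_apply u)

lemma exists_bivector_decomposition (hd : Function.Injective d) (hz : z ∉ range d)
    (hdim : Module.finrank ℝ E = Module.finrank ℝ E' + 1) {P : (E →L[ℝ] ℝ) →L[ℝ] E}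
    (hP : ∀ a b : E →L[ℝ] ℝ, b (P a) = - a (P b)) :
    ∃ (L : (E' →L[ℝ] ℝ) →L[ℝ] E') (v : E'), ∀ a b : E →L[ℝ] ℝ,
      b (P a) = (b.comp d) (L (a.comp d)) + (a z * b (d v) - b z * a (d v)) := by
  obtain ⟨p, η, -, -, -, -, hsum⟩ := exists_projections hd hz hdim
  refine ⟨p.comp (P.comp ((ContinuousLinearMap.compL ℝ E E' ℝ).flip p)), p (P η), fun a b => ?_⟩
  have hη : η (P η) = 0 := by linarith [hP η η]
  have ha : a = (a.comp d).comp p + a z • η := by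
    ext u
    have hau := congrArg a (hsum u)
    rw [map_add, map_smul, smul_eq_mul, mul_comm] at hau
    exact hau.symm
  have hdp (c : E →L[ℝ] ℝ) (u : E) : c (d (p u)) = c u - η u * c z := by
    have hcu := congrArg c (hsum u)
    rw [map_add, map_smul, smul_eq_mul] at hcu
    exact eq_sub_of_add_eq hcu
  have hPa : b (P a) = b (P ((a.comp d).comp p)) + a z * b (P η) := by
    conv_lhs => rw [ha, map_add, map_smul, map_add, map_smul, smul_eq_mul]
  have hηPa : η (P ((a.comp d).comp p)) = - a (d (p (P η))) := hP _ _
  refine hPa.trans (Eq.symm ?_)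
  refine (congrArg₂ (· + ·) (hdp b (P ((a.comp d).comp p)))
    (congrArg (fun r => a z * r - b z * a (d (p (P η)))) (hdp b (P η)))).trans ?_
  rw [hη, hηPa]
  ring

end Complements

section Straightening

lemma exists_localInverse {F G : Type*} [NormedAddCommGroup F] [NormedSpace ℝ F] [CompleteSpace F]
    [NormedAddCommGroup G] [NormedSpace ℝ G] {Ψ : F → G} {p : F} {e : F ≃L[ℝ] G}
    (hΨ : ∀ᶠ q in 𝓝 p, ContDiffAt ℝ ∞ Ψ q) (he : HasFDerivAt Ψ (e : F →L[ℝ] G) p) :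
    ∃ Φ : G → F, (∀ᶠ x in 𝓝 (Ψ p), ContDiffAt ℝ ∞ Φ x) ∧ (∀ᶠ q in 𝓝 p, Φ (Ψ q) = q) ∧
      HasFDerivAt Φ (e.symm : G →L[ℝ] F) (Ψ p) := by
  have hΨp := hΨ.self_of_nhds
  let Θ := hΨp.toOpenPartialHomeomorph Ψ he (by simp)
  have hsource : p ∈ Θ.source := hΨp.mem_toOpenPartialHomeomorph_source he (by simp)
  have htarget : Ψ p ∈ Θ.target := hΨp.image_mem_toOpenPartialHomeomorph_target he (by simp)
  have hinv : Θ.symm (Ψ p) = p := Θ.left_inv hsource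
  have hfderiv : ∀ᶠ q in 𝓝 p, fderiv ℝ Ψ q ∈ range ((↑) : (F ≃L[ℝ] G) → (F →L[ℝ] G)) := by
    have hnhds := ContinuousLinearEquiv.nhds e
    rw [← he.fderiv] at hnhds
    exact (hΨp.fderiv_right (m := 0) (by simp)).continuousAt.eventually hnhds
  have htendsto : Tendsto Θ.symm (𝓝 (Ψ p)) (𝓝 p) := by
    have hcont := Θ.continuousAt_symm htarget
    rwa [ContinuousAt, hinv] at hcont
  refine ⟨Θ.symm, ?_, ?_, ?_⟩
  · filter_upwards [Θ.open_target.mem_nhds htarget, htendsto.eventually hΨ,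
      htendsto.eventually hfderiv] with x hx hsmooth ⟨e', he'⟩
    refine Θ.contDiffAt_symm (f₀' := e') hx ?_ hsmooth
    rw [he']
    exact (hsmooth.differentiableAt (by simp)).hasFDerivAt
  · filter_upwards [Θ.open_source.mem_nhds hsource] with q hq using Θ.left_inv hq
  · refine Θ.hasFDerivAt_symm htarget ?_
    rwa [hinv]

variable {E : Type*} [NormedAddCommGroup E] [NormedSpace ℝ E] [FiniteDimensional ℝ E]
  {E' : Type*} [NormedAddCommGroup E'] [NormedSpace ℝ E'] [FiniteDimensional ℝ E']

lemma exists_straightening_of_hasFDerivAt {j : E' → E} {d : E' →L[ℝ] E} {v₀ : E'} {z : E}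
    (hj : ∀ᶠ v in 𝓝 v₀, ContDiffAt ℝ ∞ j v) (hj' : HasFDerivAt j d v₀)
    (hd : Function.Injective d) (hz : z ∉ range d)
    (hdim : Module.finrank ℝ E = Module.finrank ℝ E' + 1) :
    ∃ Φ : E → E' × ℝ, (∀ᶠ x in 𝓝 (j v₀), ContDiffAt ℝ ∞ Φ x) ∧
      (∀ᶠ v in 𝓝 v₀, Φ (j v) = (v, 0)) ∧ fderiv ℝ Φ (j v₀) z = (0, 1) := by
  obtain ⟨e, he⟩ := exists_prod_equiv hd hz hdim
  let Ψ : E' × ℝ → E := fun q => j q.1 + q.2 • z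
  have hΨj (v : E') : Ψ (v, 0) = j v := (congrArg (j v + ·) (zero_smul ℝ z)).trans (add_zero _)
  have hΨ : ∀ᶠ q in 𝓝 (v₀, (0 : ℝ)), ContDiffAt ℝ ∞ Ψ q := by
    filter_upwards [continuousAt_fst.eventually hj] with q hq
    exact (hq.comp q contDiffAt_fst).add (contDiffAt_snd.smul contDiffAt_const)
  have hΨ' : HasFDerivAt Ψ (e : E' × ℝ →L[ℝ] E) (v₀, (0 : ℝ)) := by
    have hederiv : (e : E' × ℝ →L[ℝ] E) = d.comp (ContinuousLinearMap.fst ℝ E' ℝ)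
        + (ContinuousLinearMap.snd ℝ E' ℝ).smulRight z :=
      ContinuousLinearMap.ext fun q => he q.1 q.2
    rw [hederiv]
    exact (HasFDerivAt.comp (g := j) (v₀, (0 : ℝ)) hj' hasFDerivAt_fst).add
      (hasFDerivAt_snd.smul_const z)
  obtain ⟨Φ, hΦ, hΦΨ, hΦ'⟩ := exists_localInverse hΨ hΨ'
  rw [hΨj] at hΦ hΦ'
  refine ⟨Φ, hΦ, ?_, ?_⟩
  · have htendsto : Tendsto (fun v : E' => (v, (0 : ℝ))) (𝓝 v₀) (𝓝 (v₀, 0)) :=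
      (Continuous.prodMk_left (0 : ℝ)).continuousAt
    filter_upwards [htendsto.eventually hΦΨ] with v hv
    rwa [hΨj] at hv
  · rw [hΦ'.fderiv]
    refine e.symm_apply_eq.2 ?_
    rw [he, map_zero, zero_add, one_smul]

end Straightening

section HomogeneousFunctions

variable {E : Type*} [NormedAddCommGroup E] [NormedSpace ℝ E]
  {H : Type*} [TopologicalSpace H] {I : ModelWithCorners ℝ E H}
  {M : Type*} [TopologicalSpace M] [ChartedSpace H M]
  {Z : Vec I M} {s F : M → ℝ} {x : M}

lemma SmoothFun.pow (hs : SmoothFun I s) (n : ℕ) : SmoothFun I (fun y => s y ^ n) :=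
  ContMDiff.pow hs n

lemma lieFun_pow_succ (hs : SmoothFun I s) (n : ℕ) (x : M) :
    lieFun Z (fun y => s y ^ (n + 1)) x = (n + 1) * s x ^ n * lieFun Z s x := by
  induction n with
  | zero => simp only [zero_add, pow_one, CharP.cast_eq_zero, pow_zero, one_mul]
  | succ n ih =>
    simp only [pow_succ _ (n + 1)]
    rw [lieFun_mul (hs.pow (n + 1)) hs, ih]
    push_cast
    ring

lemma exists_lieFun_eventuallyEq_add_pow_mul [FiniteDimensional ℝ E] [IsManifold I ∞ M] [T2Space M]
    (hs : SmoothFun I s) (hZ : SmoothVec I Z) (hx : lieFun Z s x ≠ 0) (hF : SmoothFun I F) (n : ℕ) :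
    ∃ G r : M → ℝ, SmoothFun I G ∧ SmoothFun I r ∧ (∀ y, s y = 0 → G y = F y) ∧
      lieFun Z G =ᶠ[𝓝 x] fun y => G y + s y ^ n * r y := by
  have hZs := hs.lieFun hZ
  induction n with
  | zero =>
    refine ⟨F, fun y => lieFun Z F y - F y, hF, (hF.lieFun hZ).sub hF, fun _ _ => rfl,
      Eventually.of_forall fun y => ?_⟩
    simp only [pow_zero, one_mul, add_sub_cancel]
  | succ n ih =>
    obtain ⟨G, r, hG, hr, hGF, hZG⟩ := ih
    have hne : ∀ᶠ y in 𝓝 x, lieFun Z s y ≠ 0 := hZs.continuous.continuousAt.eventually_ne hx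
    have hquot : ∀ᶠ y in 𝓝 x,
        ContMDiffAt I 𝓘(ℝ, ℝ) ∞ (fun y => -r y / ((n + 1) * lieFun Z s y)) y := by
      filter_upwards [hne] with y hy
      exact (hr y).neg.div₀ (((smoothFun_const ((n : ℝ) + 1)).mul hZs) y)
        (mul_ne_zero n.cast_add_one_ne_zero hy)
    obtain ⟨u, hu, hur⟩ := exists_smoothFun_eventuallyEq hquot
    have hsu := (hs.pow (n + 1)).mul hu
    refine ⟨fun y => G y + s y ^ (n + 1) * u y, fun y => lieFun Z u y - u y, hG.add hsu,
      (hu.lieFun hZ).sub hu, fun y hy => ?_, ?_⟩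
    · simp only [hy, zero_pow n.succ_ne_zero, zero_mul, add_zero, hGF y hy]
    · filter_upwards [hne, hur, hZG] with y hy huy hGy
      have hcancel : u y * ((n + 1) * lieFun Z s y) = -r y := by
        rw [huy, div_mul_cancel₀ _ (mul_ne_zero n.cast_add_one_ne_zero hy)]
      rw [lieFun_add hG hsu, lieFun_mul (hs.pow (n + 1)) hu, lieFun_pow_succ hs, hGy]
      linear_combination s y ^ n * hcancel

end HomogeneousFunctions

section TransverseHypersurfaces

variable {E : Type*} [NormedAddCommGroup E] [NormedSpace ℝ E]
  {H : Type*} [TopologicalSpace H] {I : ModelWithCorners ℝ E H}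
  {M : Type*} [TopologicalSpace M] [ChartedSpace H M]
  {E' : Type*} [NormedAddCommGroup E'] [NormedSpace ℝ E']
  {H' : Type*} [TopologicalSpace H'] {I' : ModelWithCorners ℝ E' H'}
  {N : Type*} [TopologicalSpace N] [ChartedSpace H' N]
  {Z : Vec I M} {ι : N → M} {f : N → ℝ} {y : N}

/-- `F` extends the germ of `f` at `y` to a function on `M` that is homogeneous of degree one with
respect to `Z` along the hypersurface near `y`, and to first order in all directions at `ι y`. -/
structure IsHomogeneousExtension (Z : Vec I M) (ι : N → M) (y : N) (f : N → ℝ) (F : M → ℝ) :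
    Prop where
  smoothFun : SmoothFun I F
  comp_eventuallyEq : F ∘ ι =ᶠ[𝓝 y] f
  lieFun_comp_eventuallyEq : lieFun Z F ∘ ι =ᶠ[𝓝 y] F ∘ ι
  mvfderiv_lieFun : mvfderiv I (lieFun Z F) (ι y) = mvfderiv I F (ι y)

variable [IsManifold I ∞ M] [I'.Boundaryless] [IsManifold I' ∞ N]

lemma eventually_contDiffAt_writtenInExtChartAt (hι : ContMDiff I' I ∞ ι) (y : N) :
    ∀ᶠ v in 𝓝 (extChartAt I' y y), ContDiffAt ℝ ∞ (writtenInExtChartAt I' I y ι) v := by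
  have hsymm : Tendsto (extChartAt I' y).symm (𝓝 (extChartAt I' y y)) (𝓝 y) := by
    have hcont := continuousAt_extChartAt_symm (I := I') y
    rwa [ContinuousAt, extChartAt_to_inv] at hcont
  have htendsto := hι.continuous.continuousAt.tendsto.comp hsymm
  filter_upwards [extChartAt_target_mem_nhds (I := I') y,
    htendsto.eventually (chart_source_mem_nhds H (ι y))] with v hv hιv
  have hsmooth : ContMDiffAt 𝓘(ℝ, E') I' ∞ (extChartAt I' y).symm v :=
    (contMDiffOn_extChartAt_symm (I := I') y v hv).contMDiffAt
      ((isOpen_extChartAt_target y).mem_nhds hv)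
  exact ((contMDiffAt_extChartAt' hιv).comp v ((hι _).comp v hsmooth)).contDiffAt

variable [FiniteDimensional ℝ E] [FiniteDimensional ℝ E']

lemma IsTransverseHypersurface.exists_straightening (hι : IsTransverseHypersurface I I' Z ι)
    (y : N) : ∃ ρ : M → E' × ℝ, (∀ᶠ x in 𝓝 (ι y), ContMDiffAt I 𝓘(ℝ, E' × ℝ) ∞ ρ x) ∧
      (∀ᶠ y' in 𝓝 y, ρ (ι y') = (extChartAt I' y y', 0)) ∧
      (mfderiv I 𝓘(ℝ, E' × ℝ) ρ (ι y) : E →L[ℝ] E' × ℝ) (Z (ι y)) = ((0, 1) : E' × ℝ) := by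
  have hj' : HasFDerivAt (writtenInExtChartAt I' I y ι) (mfderiv I' I ι y : E' →L[ℝ] E)
      (extChartAt I' y y) := by
    have hderiv := ((hι.smooth y).mdifferentiableAt (by simp)).hasMFDerivAt.2
    rw [I'.range_eq_univ] at hderiv
    exact hasFDerivWithinAt_univ.1 hderiv
  have hj₀ : writtenInExtChartAt I' I y ι (extChartAt I' y y) = extChartAt I (ι y) (ι y) := by
    simp only [writtenInExtChartAt, Function.comp_apply, extChartAt_to_inv]
  obtain ⟨Φ, hΦ, hΦj, hΦz⟩ := exists_straightening_of_hasFDerivAt (E := E) (E' := E')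
    (eventually_contDiffAt_writtenInExtChartAt hι.smooth y) hj' (hι.injective y)
    (hι.transverse y) hι.codim
  rw [hj₀] at hΦ hΦz
  refine ⟨Φ ∘ extChartAt I (ι y), ?_, ?_, ?_⟩
  · filter_upwards [chart_source_mem_nhds H (ι y),
      (continuousAt_extChartAt (I := I) (ι y)).eventually hΦ] with x hx hΦx
    exact hΦx.contMDiffAt.comp x (contMDiffAt_extChartAt' hx)
  · filter_upwards [extChartAt_source_mem_nhds (I := I') y,
      (continuousAt_extChartAt (I := I') y).eventually hΦj] with y' hy' hΦy'
    rwa [writtenInExtChartAt, Function.comp_apply, Function.comp_apply,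
      (extChartAt I' y).left_inv hy'] at hΦy'
  · have hchain := mfderiv_comp (ι y)
      (hΦ.self_of_nhds.differentiableAt (by simp)).mdifferentiableAt
      (mdifferentiableAt_extChartAt (I := I) (mem_chart_source H (ι y)))
    rw [mfderiv_eq_fderiv] at hchain
    have : IsManifold I 1 M := IsManifold.of_le (n := ∞) (by simp)
    refine (congrArg (fun L : E →L[ℝ] E' × ℝ => L (Z (ι y))) hchain).trans ?_
    refine Eq.trans (congrArg (fderiv ℝ Φ (extChartAt I (ι y) (ι y)))
      (congrArg (fun L : E →L[ℝ] E => L (Z (ι y))) (mfderiv_extChartAt_self (I := I)))) hΦz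

variable [T2Space M]

lemma IsTransverseHypersurface.exists_defining (hι : IsTransverseHypersurface I I' Z ι) (y : N) :
    ∃ s : M → ℝ, SmoothFun I s ∧ (∀ᶠ y' in 𝓝 y, s (ι y') = 0) ∧ lieFun Z s (ι y) = 1 := by
  obtain ⟨ρ, hρ, hρι, hρZ⟩ := hι.exists_straightening y
  have hsnd : ContMDiff 𝓘(ℝ, E' × ℝ) 𝓘(ℝ, ℝ) ∞ (Prod.snd : E' × ℝ → ℝ) :=
    contDiff_snd.contMDiff
  obtain ⟨s, hs, hsρ⟩ := exists_smoothFun_eventuallyEq (I := I) (x := ι y)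
    (hρ.mono fun x hx => (hsnd.contMDiffAt.comp x hx :))
  refine ⟨s, hs, ?_, ?_⟩
  · filter_upwards [hρι, hι.smooth.continuous.continuousAt.eventually hsρ] with y' hρy' hsy'
    rw [hsy', Function.comp_apply, hρy']
  · rw [lieFun, mvfderiv_congr hsρ]
    have hchain := mfderiv_comp (ι y) (hsnd.mdifferentiableAt (by simp))
      (hρ.self_of_nhds.mdifferentiableAt (by simp))
    rw [mfderiv_eq_fderiv, fderiv_snd] at hchain
    exact (congrArg (fun L : E →L[ℝ] ℝ => L (Z (ι y))) hchain).trans (congrArg Prod.snd hρZ)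

lemma IsTransverseHypersurface.exists_extension (hι : IsTransverseHypersurface I I' Z ι) (y : N)
    (hf : SmoothFun I' f) : ∃ F : M → ℝ, SmoothFun I F ∧ F ∘ ι =ᶠ[𝓝 y] f := by
  obtain ⟨ρ, hρ, hρι, -⟩ := hι.exists_straightening y
  have hfst : ContMDiff 𝓘(ℝ, E' × ℝ) 𝓘(ℝ, E') ∞ (Prod.fst : E' × ℝ → E') :=
    contDiff_fst.contMDiff
  have htendsto : Tendsto (fun x => (ρ x).1) (𝓝 (ι y)) (𝓝 (extChartAt I' y y)) := by
    have hcont := hρ.self_of_nhds.continuousAt.fst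
    rwa [ContinuousAt, hρι.self_of_nhds] at hcont
  have hsmooth : ∀ᶠ x in 𝓝 (ι y),
      ContMDiffAt I 𝓘(ℝ, ℝ) ∞ (fun x => f ((extChartAt I' y).symm (ρ x).1)) x := by
    filter_upwards [hρ, htendsto.eventually (extChartAt_target_mem_nhds (I := I') y)]
      with x hx hxtarget
    have hsymm : ContMDiffAt 𝓘(ℝ, E') I' ∞ (extChartAt I' y).symm (ρ x).1 :=
      (contMDiffOn_extChartAt_symm (I := I') y _ hxtarget).contMDiffAt
        ((isOpen_extChartAt_target y).mem_nhds hxtarget)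
    exact (hf _).comp x (hsymm.comp x (hfst.contMDiffAt.comp x hx))
  obtain ⟨F, hF, hFρ⟩ := exists_smoothFun_eventuallyEq hsmooth
  refine ⟨F, hF, ?_⟩
  filter_upwards [hρι, hι.smooth.continuous.continuousAt.eventually hFρ,
    extChartAt_source_mem_nhds (I := I') y] with y' hρy' hFy' hy'
  rw [Function.comp_apply, hFy', hρy']
  exact congrArg f ((extChartAt I' y).left_inv hy')

lemma IsTransverseHypersurface.exists_isHomogeneousExtension
    (hι : IsTransverseHypersurface I I' Z ι) (hZ : SmoothVec I Z) (y : N) (hf : SmoothFun I' f) :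
    ∃ F : M → ℝ, IsHomogeneousExtension Z ι y f F := by
  obtain ⟨s, hs, hsι, hsZ⟩ := hι.exists_defining y
  obtain ⟨F₀, hF₀, hF₀f⟩ := hι.exists_extension y hf
  obtain ⟨F, r, hF, hr, hFF₀, hZF⟩ :=
    exists_lieFun_eventuallyEq_add_pow_mul hs hZ (hsZ.trans_ne one_ne_zero) hF₀ 2
  refine ⟨F, hF, ?_, ?_, ?_⟩
  · filter_upwards [hsι, hF₀f] with y' hsy' hy'
    exact (hFF₀ _ hsy').trans hy'
  · filter_upwards [hsι, hι.smooth.continuous.continuousAt.eventually hZF] with y' hsy' hy'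
    rw [Function.comp_apply, hy', hsy', zero_pow two_ne_zero, zero_mul, add_zero,
      Function.comp_apply]
  · have hsq : (fun x => F x + s x ^ 2 * r x) = fun x => F x + s x * (s x * r x) := by
      funext x
      ring
    have hsr := hs.mul hr
    rw [mvfderiv_congr hZF, hsq]
    refine (mvfderiv_add (hF.mdifferentiableAt _) ((hs.mul hsr).mdifferentiableAt _)).trans ?_
    rw [mvfderiv_fun_mul hs hsr, hsι.self_of_nhds, zero_mul, zero_smul, zero_smul, add_zero,
      add_zero]

end TransverseHypersurfaces

section Decompositions

variable {E : Type*} [NormedAddCommGroup E] [NormedSpace ℝ E]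
  {H : Type*} [TopologicalSpace H] {I : ModelWithCorners ℝ E H}
  {M : Type*} [TopologicalSpace M] [ChartedSpace H M]
  {E' : Type*} [NormedAddCommGroup E'] [NormedSpace ℝ E']
  {H' : Type*} [TopologicalSpace H'] {I' : ModelWithCorners ℝ E' H'}
  {N : Type*} [TopologicalSpace N] [ChartedSpace H' N]
  {Q Q' : Biv I M} {Z : Vec I M} {ι : N → M} {Λ Λ' : Biv I' N} {V V' : Vec I' N} {f g : N → ℝ}
  {F G : M → ℝ} {y : N}

lemma DecomposesAlong.sub_smul (hD : DecomposesAlong I I' Q Z ι Λ V)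
    (hD' : DecomposesAlong I I' Q' Z ι Λ' V') (c : ℝ) :
    DecomposesAlong I I' (fun x => Q x - c • Q' x) Z ι (fun y => Λ y - c • Λ' y)
      (fun y => V y - c • V' y) := by
  intro y a b
  have hQ := hD y a b
  have hQ' := hD' y a b
  simp only [_root_.sub_apply, _root_.smul_apply, map_sub, map_smul, smul_eq_mul]
  linear_combination hQ - c * hQ'

lemma bracket_congr {f' g' : N → ℝ} (hf : f =ᶠ[𝓝 y] f') (hg : g =ᶠ[𝓝 y] g') :
    bracket I' Λ V f g y = bracket I' Λ V f' g' y := by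
  simp only [bracket, mvfderiv_congr hf, mvfderiv_congr hg, hf.eq_of_nhds, hg.eq_of_nhds]

lemma DecomposesAlong.bracket_comp (hD : DecomposesAlong I I' Q Z ι Λ V)
    (hι : MDifferentiableAt I' I ι y) (hF : MDifferentiableAt I 𝓘(ℝ, ℝ) F (ι y))
    (hG : MDifferentiableAt I 𝓘(ℝ, ℝ) G (ι y)) (hZF : lieFun Z F (ι y) = F (ι y))
    (hZG : lieFun Z G (ι y) = G (ι y)) :
    bracket I' Λ V (F ∘ ι) (G ∘ ι) y = diffBracket Q F G (ι y) := by
  have hQ := hD y (mvfderiv I F (ι y)) (mvfderiv I G (ι y))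
  simp only [mvfderiv_eq_lieFun, hZF, hZG] at hQ
  rw [bracket, mvfderiv_comp y hF hι, mvfderiv_comp y hG hι]
  exact hQ.symm

lemma IsTransverseHypersurface.mdifferentiableAt (hι : IsTransverseHypersurface I I' Z ι) (y : N) :
    MDifferentiableAt I' I ι y := (hι.smooth y).mdifferentiableAt (by simp)

lemma DecomposesAlong.restrictsBracket (hD : DecomposesAlong I I' Q Z ι Λ V)
    (hι : IsTransverseHypersurface I I' Z ι) : RestrictsBracket I I' Q Z ι Λ V :=
  fun _ _ _ hU hf hg hZf hZg _ hy => hD.bracket_comp (hι.mdifferentiableAt _)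
    ((hf.contMDiffAt (hU.mem_nhds hy)).mdifferentiableAt (by simp))
    ((hg.contMDiffAt (hU.mem_nhds hy)).mdifferentiableAt (by simp)) (hZf _ hy) (hZg _ hy)

lemma DecomposesAlong.bracket_eventuallyEq (hD : DecomposesAlong I I' Q Z ι Λ V)
    (hι : IsTransverseHypersurface I I' Z ι) (hF : IsHomogeneousExtension Z ι y f F)
    (hG : IsHomogeneousExtension Z ι y g G) :
    bracket I' Λ V f g =ᶠ[𝓝 y] diffBracket Q F G ∘ ι := by
  filter_upwards [hF.comp_eventuallyEq.eventuallyEq_nhds,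
    hG.comp_eventuallyEq.eventuallyEq_nhds, hF.lieFun_comp_eventuallyEq,
    hG.lieFun_comp_eventuallyEq] with y' hFf hGg hZF hZG
  rw [← bracket_congr hFf hGg]
  exact hD.bracket_comp (hι.mdifferentiableAt y') (hF.smoothFun.mdifferentiableAt _)
    (hG.smoothFun.mdifferentiableAt _) hZF hZG

lemma DecomposesAlong.bracket_bracket [IsManifold I ∞ M] {k : N → ℝ} {K : M → ℝ}
    (hD : DecomposesAlong I I' Q Z ι Λ V)
    (hQ : IsBivector I Q) (hH : IsHomogeneousBiv Q Z) (hι : IsTransverseHypersurface I I' Z ι)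
    (hF : IsHomogeneousExtension Z ι y f F) (hG : IsHomogeneousExtension Z ι y g G)
    (hK : IsHomogeneousExtension Z ι y k K) :
    bracket I' Λ V f (bracket I' Λ V g k) y = diffBracket Q F (diffBracket Q G K) (ι y) := by
  have hZGK : lieFun Z (diffBracket Q G K) (ι y) = diffBracket Q G K (ι y) := by
    have hleft : diffBracket Q (lieFun Z G) K (ι y) = diffBracket Q G K (ι y) := by
      simp only [diffBracket, lieFun, hamiltonian, sharp]
      exact congrArg (fun a => mvfderiv I K (ι y) (Q (ι y) a)) hG.mvfderiv_lieFun
    have hright : diffBracket Q G (lieFun Z K) (ι y) = diffBracket Q G K (ι y) :=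
      congrArg (fun a : E →L[ℝ] ℝ => a (hamiltonian Q G (ι y))) hK.mvfderiv_lieFun
    have hdefect := hH G K hG.smoothFun hK.smoothFun (ι y)
    rw [lieDefect, hleft, hright] at hdefect
    linear_combination hdefect
  rw [bracket_congr hF.comp_eventuallyEq.symm (hD.bracket_eventuallyEq hι hG hK)]
  exact hD.bracket_comp (hι.mdifferentiableAt y) (hF.smoothFun.mdifferentiableAt _)
    ((hQ.smoothFun_diffBracket hG.smoothFun hK.smoothFun).mdifferentiableAt _)
    hF.lieFun_comp_eventuallyEq.self_of_nhds hZGK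

section FiniteDimensional

variable [FiniteDimensional ℝ E] [FiniteDimensional ℝ E']

lemma IsTransverseHypersurface.exists_projections (hι : IsTransverseHypersurface I I' Z ι)
    (y : N) : ∃ (p : E →L[ℝ] E') (η : E →L[ℝ] ℝ),
      ∀ {Q : Biv I M} {Λ : Biv I' N} {V : Vec I' N}, DecomposesAlong I I' Q Z ι Λ V →
        (∀ a, Λ y a = p (Q (ι y) (a.comp p))) ∧ V y = p (Q (ι y) η) := by
  obtain ⟨p, η, hpd, hpz, hηd, hηz, -⟩ := JacobiNijenhuis.exists_projections (E := E) (E' := E')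
    (hι.injective y) (hι.transverse y) hι.codim
  exact ⟨p, η, fun hD => bivector_decomposition_eq (E := E) (E' := E') hpd hpz hηd hηz (hD y)⟩

lemma DecomposesAlong.unique (hD : DecomposesAlong I I' Q Z ι Λ V)
    (hD' : DecomposesAlong I I' Q Z ι Λ' V') (hι : IsTransverseHypersurface I I' Z ι) :
    Λ = Λ' ∧ V = V' := by
  choose p η hpη using hι.exists_projections
  exact ⟨funext fun y => ContinuousLinearMap.ext fun a =>
      ((hpη y hD).1 a).trans ((hpη y hD').1 a).symm,
    funext fun y => (hpη y hD).2.trans (hpη y hD').2.symm⟩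

variable [IsManifold I ∞ M]

lemma IsTransverseHypersurface.exists_decomposesAlong (hι : IsTransverseHypersurface I I' Z ι)
    (hQ : IsBivector I Q) : ∃ (Λ : Biv I' N) (V : Vec I' N), DecomposesAlong I I' Q Z ι Λ V := by
  choose Λ V hD using fun y => exists_bivector_decomposition (E := E) (E' := E')
    (hι.injective y) (hι.transverse y) hι.codim (hQ.skew (ι y))
  exact ⟨Λ, V, hD⟩

lemma DecomposesAlong.skew (hD : DecomposesAlong I I' Q Z ι Λ V) (hQ : IsBivector I Q)
    (hι : IsTransverseHypersurface I I' Z ι) (y : N) (a b : TangentSpace I' y →L[ℝ] ℝ) :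
    b (Λ y a) = - a (Λ y b) := by
  obtain ⟨p, η, hpη⟩ := hι.exists_projections y
  have hΛ (c : TangentSpace I' y →L[ℝ] ℝ) : Λ y c = p (Q (ι y) (c.comp p)) := (hpη hD).1 c
  have hskew := hQ.skew (ι y) (a.comp p) (b.comp p)
  rw [hΛ a, hΛ b]
  exact hskew

variable [T2Space M] [I'.Boundaryless] [IsManifold I' ∞ N]

lemma DecomposesAlong.smoothFun_bracket (hD : DecomposesAlong I I' Q Z ι Λ V)
    (hQ : IsBivector I Q) (hZ : SmoothVec I Z) (hι : IsTransverseHypersurface I I' Z ι)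
    (hf : SmoothFun I' f) (hg : SmoothFun I' g) : SmoothFun I' (bracket I' Λ V f g) := by
  intro y
  obtain ⟨F, hF⟩ := hι.exists_isHomogeneousExtension hZ y hf
  obtain ⟨G, hG⟩ := hι.exists_isHomogeneousExtension hZ y hg
  have hFG := (hQ.smoothFun_diffBracket hF.smoothFun hG.smoothFun).comp hι.smooth
  exact (hFG y).congr_of_eventuallyEq (hD.bracket_eventuallyEq hι hF hG)

lemma DecomposesAlong.smoothFun_lieFun (hD : DecomposesAlong I I' Q Z ι Λ V)
    (hQ : IsBivector I Q) (hZ : SmoothVec I Z) (hι : IsTransverseHypersurface I I' Z ι)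
    (hf : SmoothFun I' f) : SmoothFun I' (lieFun V f) := by
  have hone : bracket I' Λ V (fun _ => 1) f = lieFun V f := by
    funext y
    rw [bracket_apply, diffBracket_const_left, lieFun_const]
    ring
  exact hone ▸ hD.smoothFun_bracket hQ hZ hι (smoothFun_const 1) hf

lemma DecomposesAlong.smoothFun_diffBracket (hD : DecomposesAlong I I' Q Z ι Λ V)
    (hQ : IsBivector I Q) (hZ : SmoothVec I Z) (hι : IsTransverseHypersurface I I' Z ι)
    (hf : SmoothFun I' f) (hg : SmoothFun I' g) : SmoothFun I' (diffBracket Λ f g) := by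
  have hdiff : diffBracket Λ f g = fun y =>
      bracket I' Λ V f g y - (f y * lieFun V g y - g y * lieFun V f y) :=
    funext fun y => (add_sub_cancel_right _ _).symm
  rw [hdiff]
  exact (hD.smoothFun_bracket hQ hZ hι hf hg).sub
    ((hf.mul (hD.smoothFun_lieFun hQ hZ hι hg)).sub (hg.mul (hD.smoothFun_lieFun hQ hZ hι hf)))

theorem DecomposesAlong.isJacobi [T2Space N] (hD : DecomposesAlong I I' Q Z ι Λ V)
    (hQ : IsPoisson I Q) (hH : IsHomogeneousBiv Q Z) (hZ : SmoothVec I Z)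
    (hι : IsTransverseHypersurface I I' Z ι) : IsJacobi I' Λ V := by
  have hQbiv := hQ.isBivector
  refine ⟨isBivector_of_smoothFun_diffBracket (hD.skew hQbiv hι)
      fun f g hf hg => hD.smoothFun_diffBracket hQbiv hZ hι hf hg,
    smoothVec_of_smoothFun_lieFun fun f hf => hD.smoothFun_lieFun hQbiv hZ hι hf,
    fun f g h hf hg hh y => ?_⟩
  obtain ⟨F, hF⟩ := hι.exists_isHomogeneousExtension hZ y hf
  obtain ⟨G, hG⟩ := hι.exists_isHomogeneousExtension hZ y hg
  obtain ⟨K, hK⟩ := hι.exists_isHomogeneousExtension hZ y hh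
  rw [hD.bracket_bracket hQbiv hH hι hF hG hK, hD.bracket_bracket hQbiv hH hι hG hK hF,
    hD.bracket_bracket hQbiv hH hι hK hF hG]
  have hjac := hQ.jacobi F G K hF.smoothFun hG.smoothFun hK.smoothFun (ι y)
  have hbr (u v : M → ℝ) : bracket I Q (fun _ => 0) u v = diffBracket Q u v := by
    funext x
    simp only [bracket, map_zero, mul_zero, sub_self, add_zero]
    rfl
  simpa only [hbr] using hjac

theorem IsHomogeneousPoissonNijenhuis.isJacobi [T2Space N] {P : Biv I M} {J : Endo I M}
    (hP : IsHomogeneousPoissonNijenhuis I P J Z) (hι : IsTransverseHypersurface I I' Z ι)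
    (hD : DecomposesAlong I I' (comp I J P) Z ι Λ V) : IsJacobi I' Λ V :=
  hD.isJacobi hP.isPoissonNijenhuis.isPoisson_comp hP.isHomogeneousBiv_comp hP.smoothVec hι

end FiniteDimensional

end Decompositions

end JacobiNijenhuis

open JacobiNijenhuis in
theorem mainTheorem4_general
    {E : Type*} [NormedAddCommGroup E] [NormedSpace ℝ E] [FiniteDimensional ℝ E]
    {H : Type*} [TopologicalSpace H] (I : ModelWithCorners ℝ E H)
    {M : Type*} [TopologicalSpace M] [ChartedSpace H M] [IsManifold I ∞ M] [T2Space M] :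
    (∀ (Λ : Biv I M) (V : Vec I M) (J : Endo I M),
      IsJacobi I Λ V → IsNijenhuis I J → IsCompatible I Λ V J →
      ∃ (P : ℕ → Biv (I.prod 𝓘(ℝ, ℝ)) (M × ℝ)) (K : ℕ → Endo (I.prod 𝓘(ℝ, ℝ)) (M × ℝ)),
        ∀ k : ℕ,
          IsPoissonNijenhuis (I.prod 𝓘(ℝ, ℝ)) (P k) (K k) ∧
          IsConformalJacobiMorphism (I.prod 𝓘(ℝ, ℝ)) I (P k) (fun _ => 0)
            (comp I (power I J k) Λ) (app I (power I J k) V) (Prod.fst : M × ℝ → M)) ∧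
    (∀ {F : Type*} [NormedAddCommGroup F] [NormedSpace ℝ F] [FiniteDimensional ℝ F]
        {H' : Type*} [TopologicalSpace H'] (I' : ModelWithCorners ℝ F H') [I'.Boundaryless]
        {N : Type*} [TopologicalSpace N] [ChartedSpace H' N] [IsManifold I' ∞ N] [T2Space N]
        (P : Biv I M) (J : Endo I M) (Z : Vec I M) (ι : N → M),
      IsHomogeneousPoissonNijenhuis I P J Z → IsTransverseHypersurface I I' Z ι →
      ∃ (Λ : ℕ → Biv I' N) (V : ℕ → Vec I' N),
        (∀ k : ℕ, IsJacobi I' (Λ k) (V k)) ∧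
        (∀ k l : ℕ, AreCompatible I' (Λ k) (V k) (Λ l) (V l)) ∧
        (∀ k : ℕ, DecomposesAlong I I' (comp I (power I J k) P) Z ι (Λ k) (V k)) ∧
        (∀ k : ℕ, RestrictsBracket I I' (comp I (power I J k) P) Z ι (Λ k) (V k)) ∧
        (∀ (k : ℕ) (Λ' : Biv I' N) (V' : Vec I' N),
          DecomposesAlong I I' (comp I (power I J k) P) Z ι Λ' V' → Λ' = Λ k ∧ V' = V k)) := by
  refine ⟨fun Λ V J hΛV hJ hC => ?_, fun I' _ _ _ _ _ _ P J Z ι hP hι => ?_⟩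
  · refine ⟨fun k => poissonization (comp I (power I J k) Λ) (app I (power I J k) V),
      fun _ p => ContinuousLinearMap.id ℝ (TangentSpace (I.prod 𝓘(ℝ, ℝ)) p), fun k => ?_⟩
    have hk := hC.isJacobi_power hΛV hJ k
    exact ⟨hk.isPoisson_poissonization.isPoissonNijenhuis_id, hk.isConformalJacobiMorphism_fst⟩
  · have hPk (k : ℕ) := (hP.power k).isPoissonNijenhuis.isPoisson_comp
    choose Λ V hD using fun k => hι.exists_decomposesAlong (I' := I') (hPk k).isBivector
    have hJac (k : ℕ) : IsJacobi I' (Λ k) (V k) := (hP.power k).isJacobi hι (hD k)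
    refine ⟨Λ, V, hJac, fun k l => ⟨hJac k, hJac l, fun c => ?_⟩, hD,
      fun k => (hD k).restrictsBracket hι, fun k _ _ h => h.unique (hD k) hι⟩
    exact (hP.power_sub_smul k l c).isJacobi hι ((hD k).sub_smul (hD l) c)

theorem mainTheorem4
    {E : Type*} [NormedAddCommGroup E] [NormedSpace ℝ E] [FiniteDimensional ℝ E]
    {M : Type*} [TopologicalSpace M] [ChartedSpace E M] [IsManifold 𝓘(ℝ, E) ∞ M]
    [T2Space M] [SecondCountableTopology M] :
    (∀ (Λ : JacobiNijenhuis.Biv 𝓘(ℝ, E) M) (V : JacobiNijenhuis.Vec 𝓘(ℝ, E) M) (J : JacobiNijenhuis.Endo 𝓘(ℝ, E) M),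
      JacobiNijenhuis.IsJacobi 𝓘(ℝ, E) Λ V → JacobiNijenhuis.IsNijenhuis 𝓘(ℝ, E) J → JacobiNijenhuis.IsCompatible 𝓘(ℝ, E) Λ V J →
      ∃ (P : ℕ → JacobiNijenhuis.Biv (𝓘(ℝ, E).prod 𝓘(ℝ, ℝ)) (M × ℝ))
        (K : ℕ → JacobiNijenhuis.Endo (𝓘(ℝ, E).prod 𝓘(ℝ, ℝ)) (M × ℝ)),
        ∀ k : ℕ,
          JacobiNijenhuis.IsPoissonNijenhuis (𝓘(ℝ, E).prod 𝓘(ℝ, ℝ)) (P k) (K k) ∧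
          JacobiNijenhuis.IsConformalJacobiMorphism (𝓘(ℝ, E).prod 𝓘(ℝ, ℝ)) 𝓘(ℝ, E)
            (P k) (fun _ => 0)
            (JacobiNijenhuis.comp 𝓘(ℝ, E) (JacobiNijenhuis.power 𝓘(ℝ, E) J k) Λ) (JacobiNijenhuis.app 𝓘(ℝ, E) (JacobiNijenhuis.power 𝓘(ℝ, E) J k) V)
            (Prod.fst : M × ℝ → M)) ∧
    (∀ {F : Type*} [NormedAddCommGroup F] [NormedSpace ℝ F] [FiniteDimensional ℝ F]
        {N : Type*} [TopologicalSpace N] [ChartedSpace F N] [IsManifold 𝓘(ℝ, F) ∞ N]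
        [T2Space N] [SecondCountableTopology N]
        (P : JacobiNijenhuis.Biv 𝓘(ℝ, E) M) (J : JacobiNijenhuis.Endo 𝓘(ℝ, E) M) (Z : JacobiNijenhuis.Vec 𝓘(ℝ, E) M) (ι : N → M),
      JacobiNijenhuis.IsHomogeneousPoissonNijenhuis 𝓘(ℝ, E) P J Z →
      JacobiNijenhuis.IsTransverseHypersurface 𝓘(ℝ, E) 𝓘(ℝ, F) Z ι →
      ∃ (Λ : ℕ → JacobiNijenhuis.Biv 𝓘(ℝ, F) N) (V : ℕ → JacobiNijenhuis.Vec 𝓘(ℝ, F) N),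
        (∀ k : ℕ, JacobiNijenhuis.IsJacobi 𝓘(ℝ, F) (Λ k) (V k)) ∧
        (∀ k l : ℕ, JacobiNijenhuis.AreCompatible 𝓘(ℝ, F) (Λ k) (V k) (Λ l) (V l)) ∧
        (∀ k : ℕ, JacobiNijenhuis.DecomposesAlong 𝓘(ℝ, E) 𝓘(ℝ, F)
          (JacobiNijenhuis.comp 𝓘(ℝ, E) (JacobiNijenhuis.power 𝓘(ℝ, E) J k) P) Z ι (Λ k) (V k)) ∧
        (∀ k : ℕ, JacobiNijenhuis.RestrictsBracket 𝓘(ℝ, E) 𝓘(ℝ, F)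
          (JacobiNijenhuis.comp 𝓘(ℝ, E) (JacobiNijenhuis.power 𝓘(ℝ, E) J k) P) Z ι (Λ k) (V k)) ∧
        (∀ (k : ℕ) (Λ' : JacobiNijenhuis.Biv 𝓘(ℝ, F) N) (V' : JacobiNijenhuis.Vec 𝓘(ℝ, F) N),
          JacobiNijenhuis.DecomposesAlong 𝓘(ℝ, E) 𝓘(ℝ, F)
            (JacobiNijenhuis.comp 𝓘(ℝ, E) (JacobiNijenhuis.power 𝓘(ℝ, E) J k) P) Z ι Λ' V' →
          Λ' = Λ k ∧ V' = V k)) :=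
  have h := mainTheorem4_general 𝓘(ℝ, E) (M := M)
  ⟨h.1, fun P J Z ι => h.2 𝓘(ℝ, _) P J Z ι⟩
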